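/- Let $(\mathcal E,\pi,\mathcal M)$ be a smooth fibre bundle with $N$-dimensional fibres over an $n$-dimensional manifold $\mathcal M$, $n\ge 1$, let $\Gamma$ be a connection on it, with projection $P_\Gamma:T\mathcal E\to V\mathcal E$ onto the vertical bundle $V\mathcal E=\ker T\pi$, and let $\Lambda$ be a linear connection on $T\mathcal M$. Let $$\mathcal P=V^*\mathcal E\otimes T\mathcal M\otimes\Lambda^nT^*\mathcal M$$ be the polysymplectic phase space (a vector bundle over $\mathcal E$), with projections $(\pi^1_0)^\star:\mathcal P\to\mathcal E$ and $(\pi_1)^\star=\pi\circ(\pi^1_0)^\star:\mathcal P\to\mathcal M$. Bundle coordinates $(x^\mu,v^A)$ of $\mathcal E$ induce coordinates $(x^\mu,v^A,p^\mu_A)$ of $\mathcal P$. Let $P_\Gamma\partial_\mu=-\Gamma^A_\mu\partial_A$ and $\nabla_{\partial_\mu}\partial_\sigma=\Lambda^\nu_{\mu\sigma}\partial_\nu$, and let $\bar\Gamma$ be the connection on $\mathcal P\to\mathcal M$ induced by $\Gamma$ and $\Lambda$, whose horizontal lift of $\partial_\mu$ is $$\partial_\mu+\Gamma^A_\mu\partial_A+\bar\Gamma^{\nu}_{\mu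 A}\,\partial^A_\nu,\qquad \bar\Gamma^\nu_{\mu A}=-\partial_A\Gamma^B_\mu\,p^\nu_B-\Lambda^\nu_{\mu\sigma}p^\sigma_A+\Lambda^\rho_{\mu\rho}p^\nu_A ,\qquad \partial^A_\nu=\partial/\partial p^\nu_A .$$ Put $e^A=dv^A-\Gamma^A_\mu dx^\mu$ and $e^\mu_A=dp^\mu_A-\bar\Gamma^\mu_{\nu A}dx^\nu$. The vertical differential $d_{\bar\Gamma}:\Omega^r(\mathcal P)\to\Omega^{r+1}(\mathcal P)$ is the graded derivation with $d_{\bar\Gamma}f=\partial_Af\,e^A+\partial_\mu^Af\,e^\mu_A$ and $d_{\bar\Gamma}dx^\mu=d_{\bar\Gamma}e^A=d_{\bar\Gamma}e^\mu_A=0$. Let $\Theta_\Gamma$ be the $n$-form on $\mathcal P$ given by $$(\Theta_\Gamma)_{\alpha\otimes\omega}(X_1,\dots,X_n)=\sum_{\sigma}\frac{\operatorname{sgn}\sigma}{n!}\,\omega\bigl(\alpha(P_\Gamma T(\pi^1_0)^\star X_{\sigma(1)}),T(\pi_1)^\star X_{\sigma(2)},\dots,T(\pi_1)^\star X_{\sigma(n)}\bigr)$$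 (extended linearly in $\alpha\otimes\omega$), and let $\Omega_\Gamma=-d_{\bar\Gamma}\Theta_\Gamma$. A smooth vector field $X$ on $\mathcal P$ is called Hamiltonian, with Hamiltonian form $H$, if $H$ is a smooth $(n-1)$-form on $\mathcal P$ that is horizontal over $\mathcal M$ and $d_{\bar\Gamma}H=X\lrcorner\Omega_\Gamma$. (a) If $n\ge 2$, then every Hamiltonian vector field $X$ on $\mathcal P$ is projectable along $(\pi^1_0)^\star$ onto $\mathcal E$: there is a smooth vector field $Y$ on $\mathcal E$ with $T(\pi^1_0)^\star\circ X=Y\circ(\pi^1_0)^\star$. (b) Conversely, let $X$ be a smooth $\pi$-vertical vector field on $\mathcal E$, locally $X=X^A\partial_A$. Its canonical lift $\hat X$ to $\mathcal P$, which in all bundle coordinates is $$\hat X=X^A\partial_A-p^\nu_B\,(\partial_AX^B)\,\partial^A_\nu ,$$ is a well-defined vector field, it is Hamiltonian, and $I(X)=\hat X\lrcorner\Theta_\Gamma$ is a Hamiltonian $(n-1)$-form for it. -/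

import Mathlib

open Set Manifold TensorProduct
open scoped ContDiff

noncomputable section

/-- A smooth fibre bundle `(E, π, M)` with typical fibre `F`: the base `M` is an `n`-dimensional
manifold, the fibre `F` an `N`-dimensional one, and the projection is locally trivial by
diffeomorphisms `π⁻¹(U) ≅ U × F`. -/
structure SmoothFibreBundle (n N : ℕ) (M E F : Type*)
    [TopologicalSpace M] [ChartedSpace (EuclideanSpace ℝ (Fin n)) M]
    [TopologicalSpace E] [ChartedSpace (EuclideanSpace ℝ (Fin (n + N))) E]
    [TopologicalSpace F] [ChartedSpace (EuclideanSpace ℝ (Fin N)) F] where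
  proj : E → M
  contMDiff_proj : ContMDiff (𝓡 (n + N)) (𝓡 n) ∞ proj
  exists_trivialization : ∀ m : M, ∃ t : Bundle.Trivialization F proj, m ∈ t.baseSet ∧
    ContMDiffOn (𝓡 (n + N)) ((𝓡 n).prod (𝓡 N)) ∞ t t.source ∧
    ContMDiffOn ((𝓡 n).prod (𝓡 N)) (𝓡 (n + N)) ∞ t.toOpenPartialHomeomorph.symm t.target

namespace SmoothFibreBundle

/-- The model space `(ℝⁿ × ℝᴺ) × Hom(ℝᴺ, ℝⁿ)` of the coordinates `(x^μ, v^A, p^μ_A)`. -/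
abbrev PhaseModel (n N : ℕ) : Type :=
  (EuclideanSpace ℝ (Fin n) × EuclideanSpace ℝ (Fin N)) ×
    (EuclideanSpace ℝ (Fin N) →L[ℝ] EuclideanSpace ℝ (Fin n))

/-- The projection `(u, w, s) ↦ (0, w, s)` that removes the `∂_μ` components. -/
def vertPart (n N : ℕ) : PhaseModel n N →L[ℝ] PhaseModel n N :=
  ((0 : (EuclideanSpace ℝ (Fin n) × EuclideanSpace ℝ (Fin N)) →L[ℝ]
        EuclideanSpace ℝ (Fin n)).prod
      (ContinuousLinearMap.snd ℝ (EuclideanSpace ℝ (Fin n)) (EuclideanSpace ℝ (Fin N)))).prodMap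
    (ContinuousLinearMap.id ℝ (EuclideanSpace ℝ (Fin N) →L[ℝ] EuclideanSpace ℝ (Fin n)))

/-- The volume form `dⁿx` of `ℝⁿ`. -/
def stdVol (n : ℕ) : EuclideanSpace ℝ (Fin n) [⋀^Fin n]→L[ℝ] ℝ :=
  { (EuclideanSpace.basisFun (Fin n) ℝ).toBasis.det with
    cont := by
      change Continuous fun v : Fin n → EuclideanSpace ℝ (Fin n) =>
        (EuclideanSpace.basisFun (Fin n) ℝ).toBasis.det v
      simp only [Module.Basis.det_apply]
      apply Continuous.matrix_det
      refine continuous_matrix fun i j => ?_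
      simp only [Module.Basis.toMatrix_apply]
      simp
      fun_prop }

theorem stdVol_single (n : ℕ) :
    stdVol n (fun i => EuclideanSpace.single i (1 : ℝ)) = 1 := by
  have h := (EuclideanSpace.basisFun (Fin n) ℝ).toBasis.det_self
  have hb : ⇑(EuclideanSpace.basisFun (Fin n) ℝ).toBasis =
      fun i => EuclideanSpace.single i (1 : ℝ) := by
    funext i; simp
  rw [hb] at h
  exact h

/-- An `n`-form on `ℝⁿ` is a number: its value on the standard basis, i.e. its coefficient with
respect to `dⁿx`. -/
def volCoeff (n : ℕ) : (EuclideanSpace ℝ (Fin n) [⋀^Fin n]→L[ℝ] ℝ) ≃ₗ[ℝ] ℝ :=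
  LinearEquiv.ofBijective
    { toFun := fun η => η (fun i => EuclideanSpace.single i (1 : ℝ))
      map_add' := fun _ _ => rfl
      map_smul' := fun _ _ => rfl }
    (by
      constructor
      · rw [injective_iff_map_eq_zero]
        intro η hη
        apply ContinuousAlternatingMap.toAlternatingMap_injective
        have h := η.toAlternatingMap.eq_smul_basis_det (EuclideanSpace.basisFun (Fin n) ℝ).toBasis
        rw [h]
        have : η.toAlternatingMap ⇑(EuclideanSpace.basisFun (Fin n) ℝ).toBasis = 0 := by
          have hb : ⇑(EuclideanSpace.basisFun (Fin n) ℝ).toBasis =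
              fun i => EuclideanSpace.single i (1 : ℝ) := by
            funext i; simp
          rw [hb]
          exact hη
        rw [this, zero_smul]; rfl
      · intro c
        refine ⟨c • stdVol n, ?_⟩
        change c • stdVol n (fun i => EuclideanSpace.single i (1 : ℝ)) = c
        rw [stdVol_single, smul_eq_mul, mul_one])

theorem volCoeff_apply (n : ℕ) (η : EuclideanSpace ℝ (Fin n) [⋀^Fin n]→L[ℝ] ℝ) :
    volCoeff n η = η (fun i => EuclideanSpace.single i (1 : ℝ)) := rfl

theorem volCoeff_symm_apply (n : ℕ) (c : ℝ) : (volCoeff n).symm c = c • stdVol n := by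
  rw [LinearEquiv.symm_apply_eq, volCoeff_apply]
  change c = c • stdVol n (fun i => EuclideanSpace.single i (1 : ℝ))
  rw [stdVol_single, smul_eq_mul, mul_one]

variable {n N : ℕ} {M E F : Type*}
  [TopologicalSpace M] [ChartedSpace (EuclideanSpace ℝ (Fin n)) M]
  [TopologicalSpace E] [ChartedSpace (EuclideanSpace ℝ (Fin (n + N))) E]
  [TopologicalSpace F] [ChartedSpace (EuclideanSpace ℝ (Fin N)) F]
  (B : SmoothFibreBundle n N M E F)

/-- Local coordinates `(x^μ, v^A)` of the bundle: smooth charts `base` of `M` and `tot` of `E`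
such that `tot` followed by the projection to `ℝⁿ` is `base ∘ π`. -/
structure AdaptedChart where
  base : OpenPartialHomeomorph M (EuclideanSpace ℝ (Fin n))
  tot : OpenPartialHomeomorph E (EuclideanSpace ℝ (Fin n) × EuclideanSpace ℝ (Fin N))
  base_smooth : ContMDiffOn (𝓡 n) (𝓡 n) ∞ base base.source
  base_symm_smooth : ContMDiffOn (𝓡 n) (𝓡 n) ∞ base.symm base.target
  tot_smooth : ContMDiffOn (𝓡 (n + N))
    𝓘(ℝ, EuclideanSpace ℝ (Fin n) × EuclideanSpace ℝ (Fin N)) ∞ tot tot.source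
  tot_symm_smooth : ContMDiffOn 𝓘(ℝ, EuclideanSpace ℝ (Fin n) × EuclideanSpace ℝ (Fin N))
    (𝓡 (n + N)) ∞ tot.symm tot.target
  proj_mem : ∀ e ∈ tot.source, B.proj e ∈ base.source
  fst_tot : ∀ e ∈ tot.source, (tot e).1 = base (B.proj e)

/-- The differential `T_e π : T_e E → T_m M`, `m = π e`. -/
abbrev tangentProj (e : E) :
    TangentSpace (𝓡 (n + N)) e →L[ℝ] TangentSpace (𝓡 n) (B.proj e) :=
  mfderiv (𝓡 (n + N)) (𝓡 n) B.proj e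

/-- The vertical tangent space `V_e E = ker T_e π`. -/
abbrev VertAt (e : E) : Submodule ℝ (TangentSpace (𝓡 (n + N)) e) :=
  LinearMap.ker (B.tangentProj e).toLinearMap

/-- The fibre `V_e^* E ⊗ T_m M ⊗ Λⁿ T_m^* M` of the polysymplectic phase space over `e`, where
`m = π e`; the first two factors are written as linear maps `V_e E → T_m M`. -/
abbrev PhaseFibre (e : E) : Type :=
  (B.VertAt e →L[ℝ] TangentSpace (𝓡 n) (B.proj e)) ⊗[ℝ]
    (TangentSpace (𝓡 n) (B.proj e) [⋀^Fin n]→L[ℝ] ℝ)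

/-- The polysymplectic phase space `P = V^*E ⊗ TM ⊗ Λⁿ T^*M`. -/
def Phase : Type _ := Σ e : E, B.PhaseFibre e

namespace AdaptedChart

variable {B} (c : B.AdaptedChart)

theorem base_mdifferentiable : c.base.MDifferentiable (𝓡 n) (𝓡 n) :=
  ⟨c.base_smooth.mdifferentiableOn (by simp), c.base_symm_smooth.mdifferentiableOn (by simp)⟩

theorem tot_mdifferentiable : c.tot.MDifferentiable (𝓡 (n + N))
    𝓘(ℝ, EuclideanSpace ℝ (Fin n) × EuclideanSpace ℝ (Fin N)) :=
  ⟨c.tot_smooth.mdifferentiableOn (by simp), c.tot_symm_smooth.mdifferentiableOn (by simp)⟩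

/-- The differential `T_m M → ℝⁿ` of the base coordinates. -/
def dBase (m : M) : TangentSpace (𝓡 n) m →L[ℝ] EuclideanSpace ℝ (Fin n) :=
  mfderiv (𝓡 n) (𝓡 n) c.base m

/-- The differential `T_e E → ℝⁿ × ℝᴺ` of the coordinates of `E`. -/
def dTot (e : E) :
    TangentSpace (𝓡 (n + N)) e →L[ℝ] EuclideanSpace ℝ (Fin n) × EuclideanSpace ℝ (Fin N) :=
  mfderiv (𝓡 (n + N)) 𝓘(ℝ, EuclideanSpace ℝ (Fin n) × EuclideanSpace ℝ (Fin N)) c.tot e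

/-- The isomorphism `T_m M ≅ ℝⁿ`, given by the coordinates, at `m = π e`. -/
def baseEquiv {e : E} (he : e ∈ c.tot.source) :
    TangentSpace (𝓡 n) (B.proj e) ≃L[ℝ] EuclideanSpace ℝ (Fin n) :=
  c.base_mdifferentiable.mfderiv (c.proj_mem e he)

/-- The isomorphism `T_e E ≅ ℝⁿ × ℝᴺ`, given by the coordinates. -/
def totEquiv {e : E} (he : e ∈ c.tot.source) :
    TangentSpace (𝓡 (n + N)) e ≃L[ℝ] EuclideanSpace ℝ (Fin n) × EuclideanSpace ℝ (Fin N) :=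
  c.tot_mdifferentiable.mfderiv he

theorem fst_totEquiv {e : E} (he : e ∈ c.tot.source) (w : TangentSpace (𝓡 (n + N)) e) :
    (c.totEquiv he w).1 = c.baseEquiv he (B.tangentProj e w) := by
  have hp : MDifferentiableAt (𝓡 (n + N)) (𝓡 n) B.proj e :=
    B.contMDiff_proj.mdifferentiableAt (by simp)
  have hb := c.base_mdifferentiable.mdifferentiableAt (c.proj_mem e he)
  have ht := c.tot_mdifferentiable.mdifferentiableAt he
  have h1 := ht.hasMFDerivAt
  have h2 : HasMFDerivAt 𝓘(ℝ, EuclideanSpace ℝ (Fin n) × EuclideanSpace ℝ (Fin N)) (𝓡 n)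
      (Prod.fst : EuclideanSpace ℝ (Fin n) × EuclideanSpace ℝ (Fin N) → _) (c.tot e)
      (ContinuousLinearMap.fst ℝ (EuclideanSpace ℝ (Fin n)) (EuclideanSpace ℝ (Fin N))) :=
    hasFDerivAt_fst.hasMFDerivAt
  have h3 := h2.comp e h1
  have h4 := hb.hasMFDerivAt.comp e hp.hasMFDerivAt
  have h5 : (c.base ∘ B.proj) =ᶠ[nhds e] (Prod.fst ∘ c.tot) := by
    filter_upwards [c.tot.open_source.mem_nhds he] with e' he'
    exact (c.fst_tot e' he').symm
  have h6 := hasMFDerivAt_unique h3 (h4.congr_of_eventuallyEq h5.symm)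
  exact congrArg (fun f => f w) h6

/-- The isomorphism `V_e E ≅ ℝᴺ`, given by the coordinates. -/
def vertEquiv {e : E} (he : e ∈ c.tot.source) :
    B.VertAt e ≃L[ℝ] EuclideanSpace ℝ (Fin N) where
  toFun w := (c.totEquiv he w).2
  map_add' _ _ := by simp
  map_smul' _ _ := by simp
  invFun a := ⟨(c.totEquiv he).symm (0, a), by
    have h := c.fst_totEquiv he ((c.totEquiv he).symm (0, a))
    rw [ContinuousLinearEquiv.apply_symm_apply] at h
    exact (c.baseEquiv he).injective (by rw [map_zero]; exact h.symm)⟩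
  left_inv w := by
    apply Subtype.ext
    change (c.totEquiv he).symm (0, (c.totEquiv he w).2) = w
    rw [ContinuousLinearEquiv.symm_apply_eq]
    have h : (c.totEquiv he w).1 = 0 := by
      rw [c.fst_totEquiv he, show B.tangentProj e w = 0 from w.2, map_zero]
    exact Prod.ext h.symm rfl
  right_inv a := by simp
  continuous_toFun := by
    exact continuous_snd.comp ((c.totEquiv he).continuous.comp continuous_subtype_val)
  continuous_invFun := by
    refine Continuous.subtype_mk ?_ _
    exact (c.totEquiv he).symm.continuous.comp (by fun_prop)

/-- The coordinates `p^μ_A` on the fibre of `P` over `e`: a sum of elements `α ⊗ ω` is sent to the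
sum of the maps `ω(∂_1, …, ∂_n) α^μ_A`. -/
def fibreEquiv {e : E} (he : e ∈ c.tot.source) :
    B.PhaseFibre e ≃ₗ[ℝ] (EuclideanSpace ℝ (Fin N) →L[ℝ] EuclideanSpace ℝ (Fin n)) :=
  (TensorProduct.congr ((c.vertEquiv he).arrowCongr (c.baseEquiv he)).toLinearEquiv
    ((c.baseEquiv he).continuousAlternatingMapCongrLeft (F := ℝ) (ι := Fin n)).toLinearEquiv)
  ≪≫ₗ (TensorProduct.congr (LinearEquiv.refl ℝ _) (volCoeff n)) ≪≫ₗ TensorProduct.rid ℝ _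

theorem fibreEquiv_tmul {e : E} (he : e ∈ c.tot.source)
    (α : B.VertAt e →L[ℝ] TangentSpace (𝓡 n) (B.proj e))
    (η : TangentSpace (𝓡 n) (B.proj e) [⋀^Fin n]→L[ℝ] ℝ) :
    c.fibreEquiv he (α ⊗ₜ η) =
      η (fun i => (c.baseEquiv he).symm (EuclideanSpace.single i 1)) •
        ((c.baseEquiv he : _ →L[ℝ] _) ∘L α ∘L ((c.vertEquiv he).symm : _ →L[ℝ] _)) := by
  rfl

theorem fibreEquiv_symm_apply {e : E} (he : e ∈ c.tot.source)
    (p : EuclideanSpace ℝ (Fin N) →L[ℝ] EuclideanSpace ℝ (Fin n)) :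
    (c.fibreEquiv he).symm p =
      (((c.baseEquiv he).symm : _ →L[ℝ] _) ∘L p ∘L (c.vertEquiv he : _ →L[ℝ] _)) ⊗ₜ
        (stdVol n).compContinuousLinearMap (c.baseEquiv he : _ →L[ℝ] _) := by
  rw [LinearEquiv.symm_apply_eq, fibreEquiv_tmul]
  have : ((stdVol n).compContinuousLinearMap (c.baseEquiv he : _ →L[ℝ] _))
      (fun i => (c.baseEquiv he).symm (EuclideanSpace.single i 1)) = 1 := by
    refine Eq.trans ?_ (stdVol_single n)
    simp [Function.comp_def]
  rw [this, one_smul]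
  ext a
  simp

open Classical in
/-- The coordinates `(x^μ, v^A, p^μ_A)` of `P` that come from adapted coordinates of the bundle. -/
def phaseEquiv : PartialEquiv B.Phase (PhaseModel n N) where
  toFun q := (c.tot q.1, if h : q.1 ∈ c.tot.source then c.fibreEquiv h q.2 else 0)
  invFun y := ⟨c.tot.symm y.1, if h : y.1 ∈ c.tot.target then
    (c.fibreEquiv (c.tot.map_target h)).symm y.2 else 0⟩
  source := {q | q.1 ∈ c.tot.source}
  target := {y | y.1 ∈ c.tot.target}
  map_source' q hq := c.tot.map_source hq
  map_target' y hy := c.tot.map_target hy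
  left_inv' := by
    rintro ⟨e, p⟩ (he : e ∈ c.tot.source)
    have key : ∀ (e' : E) (he' : e' ∈ c.tot.source), e' = e →
        (⟨e', (c.fibreEquiv he').symm (c.fibreEquiv he p)⟩ : Σ e : E, B.PhaseFibre e) = ⟨e, p⟩ := by
      rintro e' he' rfl
      rw [LinearEquiv.symm_apply_apply]
    simp only [he, c.tot.map_source he, dif_pos]
    exact key _ _ (c.tot.left_inv he)
  right_inv' := by
    rintro ⟨y, p⟩ (hy : y ∈ c.tot.target)
    simp only [hy, c.tot.map_target hy, dif_pos, LinearEquiv.apply_symm_apply,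
      c.tot.right_inv hy]

/-- Change of fibre coordinates of `P`. -/
theorem fibreEquiv_symm_trans (c' : B.AdaptedChart) {e : E} (he : e ∈ c.tot.source)
    (he' : e ∈ c'.tot.source)
    (p : EuclideanSpace ℝ (Fin N) →L[ℝ] EuclideanSpace ℝ (Fin n)) :
    c'.fibreEquiv he' ((c.fibreEquiv he).symm p) =
      (stdVol n fun i => c.baseEquiv he ((c'.baseEquiv he').symm (EuclideanSpace.single i 1))) •
        (((c'.baseEquiv he' : _ →L[ℝ] _) ∘L
            ((c.baseEquiv he).symm : _ →L[ℝ] TangentSpace (𝓡 n) (B.proj e))) ∘L p ∘L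
          ((c.vertEquiv he : _ →L[ℝ] _) ∘L
            ((c'.vertEquiv he').symm : _ →L[ℝ] B.VertAt e))) := by
  rw [fibreEquiv_symm_apply, fibreEquiv_tmul]
  rfl

/-- The coordinate change `tot' ∘ tot⁻¹` of two adapted charts. -/
abbrev transition (c' : B.AdaptedChart) :
    EuclideanSpace ℝ (Fin n) × EuclideanSpace ℝ (Fin N) →
      EuclideanSpace ℝ (Fin n) × EuclideanSpace ℝ (Fin N) :=
  c'.tot ∘ c.tot.symm

/-- The domain of the coordinate change. -/
abbrev overlap (c' : B.AdaptedChart) :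
    Set (EuclideanSpace ℝ (Fin n) × EuclideanSpace ℝ (Fin N)) :=
  (c.tot.symm ≫ₕ c'.tot).source

theorem contDiffOn_transition (c' : B.AdaptedChart) :
    ContDiffOn ℝ ∞ (c.transition c') (c.overlap c') := by
  rw [← contMDiffOn_iff_contDiffOn]
  exact c'.tot_smooth.comp (c.tot_symm_smooth.mono fun y hy => hy.1) fun y hy => hy.2

theorem fderiv_transition (c' : B.AdaptedChart) {e : E} (he : e ∈ c.tot.source)
    (he' : e ∈ c'.tot.source) (w : EuclideanSpace ℝ (Fin n) × EuclideanSpace ℝ (Fin N)) :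
    fderiv ℝ (c.transition c') (c.tot e) w = c'.totEquiv he' ((c.totEquiv he).symm w) := by
  have h1 := (c.tot_mdifferentiable.mdifferentiableAt_symm (c.tot.map_source he)).hasMFDerivAt
  have h2 : HasMFDerivAt (𝓡 (n + N)) 𝓘(ℝ, EuclideanSpace ℝ (Fin n) × EuclideanSpace ℝ (Fin N))
      c'.tot (c.tot.symm (c.tot e)) (mfderiv (𝓡 (n + N))
        𝓘(ℝ, EuclideanSpace ℝ (Fin n) × EuclideanSpace ℝ (Fin N)) c'.tot e) := by
    rw [c.tot.left_inv he]
    exact (c'.tot_mdifferentiable.mdifferentiableAt he').hasMFDerivAt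
  have h3 := h2.comp (c.tot e) h1
  have h4 : HasFDerivAt (c.transition c') ((c'.totEquiv he' : _ →L[ℝ] _) ∘L
      ((c.totEquiv he).symm : _ →L[ℝ] TangentSpace (𝓡 (n + N)) e)) (c.tot e) :=
    hasMFDerivAt_iff_hasFDerivAt.1 h3
  rw [h4.fderiv]
  rfl

theorem vertEquiv_symm_val {e : E} (he : e ∈ c.tot.source) (a : EuclideanSpace ℝ (Fin N)) :
    (((c.vertEquiv he).symm a : B.VertAt e) : TangentSpace (𝓡 (n + N)) e) =
      (c.totEquiv he).symm (0, a) := rfl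

theorem transition_vert (c' : B.AdaptedChart) {e : E} (he : e ∈ c.tot.source)
    (he' : e ∈ c'.tot.source) (a : EuclideanSpace ℝ (Fin N)) :
    c'.vertEquiv he' ((c.vertEquiv he).symm a) =
      (fderiv ℝ (c.transition c') (c.tot e) (0, a)).2 := by
  rw [c.fderiv_transition c' he he']
  rfl

theorem transition_base (c' : B.AdaptedChart) {e : E} (he : e ∈ c.tot.source)
    (he' : e ∈ c'.tot.source) (u : EuclideanSpace ℝ (Fin n)) :
    c'.baseEquiv he' ((c.baseEquiv he).symm u) =
      (fderiv ℝ (c.transition c') (c.tot e) (u, 0)).1 := by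
  rw [c.fderiv_transition c' he he', fst_totEquiv]
  congr 1
  rw [ContinuousLinearEquiv.symm_apply_eq, ← fst_totEquiv,
    ContinuousLinearEquiv.apply_symm_apply]

/-- The horizontal block of the derivative of a coordinate change. -/
def blockBase (L : EuclideanSpace ℝ (Fin n) × EuclideanSpace ℝ (Fin N) →L[ℝ]
      EuclideanSpace ℝ (Fin n) × EuclideanSpace ℝ (Fin N)) :
    EuclideanSpace ℝ (Fin n) →L[ℝ] EuclideanSpace ℝ (Fin n) :=
  (ContinuousLinearMap.fst ℝ _ _ ∘L L) ∘L ContinuousLinearMap.inl ℝ _ _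

/-- The vertical block of the derivative of a coordinate change. -/
def blockVert (L : EuclideanSpace ℝ (Fin n) × EuclideanSpace ℝ (Fin N) →L[ℝ]
      EuclideanSpace ℝ (Fin n) × EuclideanSpace ℝ (Fin N)) :
    EuclideanSpace ℝ (Fin N) →L[ℝ] EuclideanSpace ℝ (Fin N) :=
  (ContinuousLinearMap.snd ℝ _ _ ∘L L) ∘L ContinuousLinearMap.inr ℝ _ _

theorem contDiff_blockBase : ContDiff ℝ ∞ (blockBase (n := n) (N := N)) := by
  unfold blockBase; fun_prop

theorem contDiff_blockVert : ContDiff ℝ ∞ (blockVert (n := n) (N := N)) := by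
  unfold blockVert; fun_prop

/-- The coordinate change of `P` in terms of that of `E`. -/
def phaseTransition (c' : B.AdaptedChart) (y : PhaseModel n N) : PhaseModel n N :=
  let A := fderiv ℝ (c.transition c') y.1
  let A' := fderiv ℝ (c'.transition c) (c.transition c' y.1)
  (c.transition c' y.1,
    (stdVol n fun i => blockBase A' (EuclideanSpace.single i 1)) •
      (blockBase A ∘L y.2 ∘L blockVert A'))

open Classical in
theorem phaseEquiv_transition (c' : B.AdaptedChart) {y : PhaseModel n N}
    (hy : y.1 ∈ c.overlap c') :
    c'.phaseEquiv (c.phaseEquiv.symm y) = c.phaseTransition c' y := by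
  obtain ⟨z, p⟩ := y
  obtain ⟨hz, hz'⟩ : z ∈ c.tot.target ∧ c.tot.symm z ∈ c'.tot.source := hy
  have he := c.tot.map_target hz
  have h1 : c'.phaseEquiv (c.phaseEquiv.symm (z, p)) = (c.transition c' z,
      c'.fibreEquiv hz' ((c.fibreEquiv he).symm p)) := by
    change (c'.tot (c.tot.symm z), if h : c.tot.symm z ∈ c'.tot.source then
      c'.fibreEquiv h (if h : z ∈ c.tot.target then
    (c.fibreEquiv (c.tot.map_target h)).symm p else 0) else 0) = _
    rw [dif_pos hz', dif_pos hz]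
    rfl
  rw [h1, fibreEquiv_symm_trans]
  have hb := fun u => c.transition_base c' he hz' u
  have hb' := fun u => c'.transition_base c hz' he u
  have hv' := fun u => c'.transition_vert c hz' he u
  rw [c.tot.right_inv hz] at hb
  unfold phaseTransition
  refine Prod.ext rfl ?_
  simp only [hb', blockBase]
  congr 1
  ext a i
  simp [hb, hv', blockVert]

theorem contDiffOn_phaseTransition (c' : B.AdaptedChart) :
    ContDiffOn ℝ ∞ (c.phaseTransition c') {y | y.1 ∈ c.overlap c'} := by
  have h1 : ContDiffOn ℝ ∞ (fun y : PhaseModel n N => c.transition c' y.1)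
      {y | y.1 ∈ c.overlap c'} :=
    (c.contDiffOn_transition c').comp contDiff_fst.contDiffOn fun y hy => hy
  have h2 : ContDiffOn ℝ ∞ (fun y : PhaseModel n N => fderiv ℝ (c.transition c') y.1)
      {y | y.1 ∈ c.overlap c'} :=
    ((c.contDiffOn_transition c').fderiv_of_isOpen (c.tot.symm ≫ₕ c'.tot).open_source
      (by simp)).comp contDiff_fst.contDiffOn fun y hy => hy
  have h3 : ContDiffOn ℝ ∞ (fun y : PhaseModel n N =>
      fderiv ℝ (c'.transition c) (c.transition c' y.1)) {y | y.1 ∈ c.overlap c'} := by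
    refine ((c'.contDiffOn_transition c).fderiv_of_isOpen (c'.tot.symm ≫ₕ c.tot).open_source
      (m := ∞) (by simp)).comp h1 fun y hy => ?_
    refine ⟨c'.tot.map_source hy.2, ?_⟩
    have h : c'.tot.symm (c'.tot (c.tot.symm y.1)) = c.tot.symm y.1 := c'.tot.left_inv hy.2
    change c'.tot.symm (c'.tot (c.tot.symm y.1)) ∈ c.tot.source
    rw [h]
    exact c.tot.map_target hy.1
  have h4 := contDiff_blockBase.comp_contDiffOn h2
  have h5 := contDiff_blockBase.comp_contDiffOn h3
  have h6 := contDiff_blockVert.comp_contDiffOn h3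
  have h7 : ContDiffOn ℝ ∞ (fun y : PhaseModel n N => stdVol n fun i =>
      blockBase (fderiv ℝ (c'.transition c) (c.transition c' y.1)) (EuclideanSpace.single i 1))
      {y | y.1 ∈ c.overlap c'} := by
    refine (stdVol n).toContinuousMultilinearMap.contDiff.comp_contDiffOn ?_
    rw [contDiffOn_pi]
    intro i
    exact h5.clm_apply contDiffOn_const
  exact h1.prodMk (h7.smul (h4.clm_comp (contDiff_snd.contDiffOn.clm_comp h6)))

end AdaptedChart

theorem phaseEquiv_overlap (c c' : B.AdaptedChart) :
    (c.phaseEquiv.symm.trans c'.phaseEquiv).source = {y | y.1 ∈ c.overlap c'} := rfl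

theorem contDiffOn_phaseEquiv_symm_trans (c c' : B.AdaptedChart) :
    ContDiffOn ℝ ∞ (c.phaseEquiv.symm.trans c'.phaseEquiv)
      (c.phaseEquiv.symm.trans c'.phaseEquiv).source :=
  (c.contDiffOn_phaseTransition c').congr fun _ hy => c.phaseEquiv_transition c' hy

variable [IsManifold (𝓡 n) ∞ M] [IsManifold (𝓡 N) ∞ F]

theorem exists_adaptedChart (e : E) : ∃ c : B.AdaptedChart, e ∈ c.tot.source := by
  obtain ⟨t, hm, ht, ht'⟩ := B.exists_trivialization (B.proj e)
  have he : e ∈ t.source := t.mem_source.2 hm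
  let b := chartAt (EuclideanSpace ℝ (Fin n)) (B.proj e)
  let f := chartAt (EuclideanSpace ℝ (Fin N)) (t e).2
  have hb := contMDiffOn_chart (I := 𝓡 n) (n := ∞) (x := B.proj e)
  have hb' := contMDiffOn_chart_symm (I := 𝓡 n) (n := ∞) (x := B.proj e)
  have hf := contMDiffOn_chart (I := 𝓡 N) (n := ∞) (x := (t e).2)
  have hf' := contMDiffOn_chart_symm (I := 𝓡 N) (n := ∞) (x := (t e).2)
  refine ⟨{ base := b
            tot := t.toOpenPartialHomeomorph ≫ₕ b.prod f
            base_smooth := hb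
            base_symm_smooth := hb'
            tot_smooth := ?_
            tot_symm_smooth := ?_
            proj_mem := ?_
            fst_tot := ?_ }, ?_⟩
  · have h1 : ContMDiffOn (𝓡 (n + N)) (𝓡 n) ∞ (fun e' => b (t e').1)
        (t.toOpenPartialHomeomorph ≫ₕ b.prod f).source :=
      hb.comp (contMDiff_fst.comp_contMDiffOn (ht.mono fun e' he' => he'.1))
        fun e' he' => he'.2.1
    have h2 : ContMDiffOn (𝓡 (n + N)) (𝓡 N) ∞ (fun e' => f (t e').2)
        (t.toOpenPartialHomeomorph ≫ₕ b.prod f).source :=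
      hf.comp (contMDiff_snd.comp_contMDiffOn (ht.mono fun e' he' => he'.1))
        fun e' he' => he'.2.2
    exact h1.prodMk_space h2
  · have h1 : ContMDiffOn 𝓘(ℝ, EuclideanSpace ℝ (Fin n) × EuclideanSpace ℝ (Fin N)) (𝓡 n) ∞
        (fun y => b.symm y.1) (t.toOpenPartialHomeomorph ≫ₕ b.prod f).target :=
      hb'.comp contDiff_fst.contMDiff.contMDiffOn fun y hy => hy.1.1
    have h2 : ContMDiffOn 𝓘(ℝ, EuclideanSpace ℝ (Fin n) × EuclideanSpace ℝ (Fin N)) (𝓡 N) ∞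
        (fun y => f.symm y.2) (t.toOpenPartialHomeomorph ≫ₕ b.prod f).target :=
      hf'.comp contDiff_snd.contMDiff.contMDiffOn fun y hy => hy.1.2
    exact ht'.comp (h1.prodMk h2) fun y hy => hy.2
  · intro e' he'
    rw [← t.coe_fst he'.1]
    exact he'.2.1
  · intro e' he'
    change b (t e').1 = b (B.proj e')
    rw [t.coe_fst he'.1]
  · refine ⟨he, ?_, mem_chart_source _ _⟩
    change (t e).1 ∈ b.source
    rw [t.coe_fst he]
    exact mem_chart_source _ _

/-- Adapted coordinates around a point of `E`, chosen once and for all. -/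
def adaptedChartAt (e : E) : B.AdaptedChart := (B.exists_adaptedChart e).choose

theorem mem_adaptedChartAt (e : E) : e ∈ (B.adaptedChartAt e).tot.source :=
  (B.exists_adaptedChart e).choose_spec

/-- The smooth atlas of `P`: all coordinates that come from adapted coordinates of the bundle. -/
def phaseCore : ChartedSpaceCore (PhaseModel n N) B.Phase where
  atlas := range (AdaptedChart.phaseEquiv (B := B))
  chartAt q := (B.adaptedChartAt q.1).phaseEquiv
  mem_chart_source q := B.mem_adaptedChartAt q.1
  chart_mem_atlas q := mem_range_self _
  open_source := by
    rintro _ _ ⟨c, rfl⟩ ⟨c', rfl⟩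
    rw [phaseEquiv_overlap]
    exact (c.tot.symm ≫ₕ c'.tot).open_source.preimage continuous_fst
  continuousOn_toFun := by
    rintro _ _ ⟨c, rfl⟩ ⟨c', rfl⟩
    exact (B.contDiffOn_phaseEquiv_symm_trans c c').continuousOn

instance : TopologicalSpace B.Phase := B.phaseCore.toTopologicalSpace

instance : ChartedSpace (PhaseModel n N) B.Phase := B.phaseCore.toChartedSpace

variable {B} in
/-- The chart `(x^μ, v^A, p^μ_A)` of the manifold `P`. -/
def AdaptedChart.phaseChart (c : B.AdaptedChart) :
    OpenPartialHomeomorph B.Phase (PhaseModel n N) :=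
  B.phaseCore.openPartialHomeomorph c.phaseEquiv (mem_range_self c)

instance : IsManifold 𝓘(ℝ, PhaseModel n N) ∞ B.Phase := by
  apply isManifold_of_contDiffOn
  intro e e' he he'
  obtain ⟨f, hf⟩ := mem_iUnion.1 he
  obtain ⟨⟨c, rfl⟩, rfl⟩ := mem_iUnion.1 hf
  obtain ⟨f', hf'⟩ := mem_iUnion.1 he'
  obtain ⟨⟨c', rfl⟩, rfl⟩ := mem_iUnion.1 hf'
  have h := B.contDiffOn_phaseEquiv_symm_trans c c'
  simp only [modelWithCornersSelf_coe, modelWithCornersSelf_coe_symm, range_id, inter_univ,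
    Function.comp_id, Function.id_comp, preimage_id]
  exact h

/-- The projection `(π^1_0)^⋆ : P → E`. -/
def toTotal (q : B.Phase) : E := q.1

/-- The projection `(π_1)^⋆ : P → M`. -/
def toBase (q : B.Phase) : M := B.proj (B.toTotal q)

/-- The tangent space `T_q P`. -/
abbrev PhaseTangent (q : B.Phase) : Type := TangentSpace 𝓘(ℝ, PhaseModel n N) q

/-- The differential of `P → E`. -/
abbrev tangentToTotal (q : B.Phase) :
    B.PhaseTangent q →L[ℝ] TangentSpace (𝓡 (n + N)) (B.toTotal q) :=
  mfderiv 𝓘(ℝ, PhaseModel n N) (𝓡 (n + N)) B.toTotal q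

/-- The differential of `P → M`. -/
abbrev tangentToBase (q : B.Phase) :
    B.PhaseTangent q →L[ℝ] TangentSpace (𝓡 n) (B.toBase q) :=
  mfderiv 𝓘(ℝ, PhaseModel n N) (𝓡 n) B.toBase q

variable {B} in
/-- The differential `T_q P → (ℝⁿ × ℝᴺ) × Hom(ℝᴺ, ℝⁿ)` of the coordinates of `P`. -/
def AdaptedChart.dPhase (c : B.AdaptedChart) (q : B.Phase) :
    B.PhaseTangent q →L[ℝ] PhaseModel n N :=
  mfderiv 𝓘(ℝ, PhaseModel n N) 𝓘(ℝ, PhaseModel n N) c.phaseChart q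

/-- Vector fields on `P` (smoothness is a separate predicate). -/
abbrev PhaseField : Type _ := (q : B.Phase) → B.PhaseTangent q

/-- Differential forms of degree `r` on `P` (smoothness is a separate predicate). -/
abbrev PhaseForm (r : ℕ) : Type _ := (q : B.Phase) → B.PhaseTangent q [⋀^Fin r]→L[ℝ] ℝ

/-- Smooth vector fields on `P`. -/
def IsSmoothField (X : B.PhaseField) : Prop :=
  ContMDiff 𝓘(ℝ, PhaseModel n N) 𝓘(ℝ, PhaseModel n N).tangent ∞
    (fun q => (⟨q, X q⟩ : TangentBundle 𝓘(ℝ, PhaseModel n N) B.Phase))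

variable {B} in
/-- The expression of a form on `P` in coordinates: its pullback under the inverse of the chart. -/
def PhaseForm.inChart {r : ℕ} (α : B.PhaseForm r) (c : B.AdaptedChart) (y : PhaseModel n N) :
    PhaseModel n N [⋀^Fin r]→L[ℝ] ℝ :=
  (α (c.phaseChart.symm y)).compContinuousLinearMap
    (mfderiv 𝓘(ℝ, PhaseModel n N) 𝓘(ℝ, PhaseModel n N) c.phaseChart.symm y)

variable {B} in
/-- Smooth forms on `P`. -/
def PhaseForm.IsSmooth {r : ℕ} (α : B.PhaseForm r) : Prop :=
  ∀ c : B.AdaptedChart, ContDiffOn ℝ ∞ (α.inChart c) c.phaseChart.target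

variable {B} in
/-- Horizontal forms on `P` (with respect to `P → M`): they vanish as soon as one argument is
tangent to the fibres of `P → M`. -/
def PhaseForm.IsHorizontal {r : ℕ} (α : B.PhaseForm r) : Prop :=
  ∀ (q : B.Phase) (v : Fin r → B.PhaseTangent q) (i : Fin r),
    B.tangentToBase q (v i) = 0 → α q v = 0

variable {B} in
/-- The contraction `X ⌟ α`, i.e. insertion of `X` in the first argument. -/
def PhaseForm.contract {r : ℕ} (X : B.PhaseField) (α : B.PhaseForm (r + 1)) : B.PhaseForm r :=
  fun q => ContinuousAlternatingMap.curryLeft (E := PhaseModel n N) (α q) (X q)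

/-- A smooth vector field `X` on `P` is projectable along `P → E`: it is related to some smooth
vector field on `E`. -/
def IsProjectable [IsManifold (𝓡 (n + N)) ∞ E] (X : B.PhaseField) : Prop :=
  ∃ Y : (e : E) → TangentSpace (𝓡 (n + N)) e,
    ContMDiff (𝓡 (n + N)) (𝓡 (n + N)).tangent ∞
      (fun e => (⟨e, Y e⟩ : TangentBundle (𝓡 (n + N)) E)) ∧
    ∀ q : B.Phase, B.tangentToTotal q (X q) = Y (B.toTotal q)

/-- A connection `Γ` on the bundle `E → M`: a smooth projection `P_Γ` of `TE` onto the vertical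
subbundle. -/
structure Connection [IsManifold (𝓡 (n + N)) ∞ E] where
  vert : (e : E) → TangentSpace (𝓡 (n + N)) e →L[ℝ] TangentSpace (𝓡 (n + N)) e
  vert_mem : ∀ e w, vert e w ∈ B.VertAt e
  vert_of_mem : ∀ e, ∀ w ∈ B.VertAt e, vert e w = w
  smooth : ContMDiff (𝓡 (n + N)).tangent (𝓡 (n + N)).tangent ∞
    (fun z : TangentBundle (𝓡 (n + N)) E =>
      (⟨z.1, vert z.1 z.2⟩ : TangentBundle (𝓡 (n + N)) E))

section

variable [IsManifold (𝓡 (n + N)) ∞ E] {B} (Γ : B.Connection)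

/-- The projection `P_Γ` as a map `T_e E → V_e E`. -/
def Connection.toVert (e : E) : TangentSpace (𝓡 (n + N)) e →L[ℝ] B.VertAt e :=
  (Γ.vert e).codRestrict (B.VertAt e) (Γ.vert_mem e)

/-- The coefficients `Γ^A_μ` of a connection in adapted coordinates, as a map `ℝⁿ → ℝᴺ` at every
point: `P_Γ ∂_μ = - Γ^A_μ ∂_A`, so that `∂_μ + Γ^A_μ ∂_A` is horizontal. -/
def Connection.coeff (c : B.AdaptedChart)
    (y : EuclideanSpace ℝ (Fin n) × EuclideanSpace ℝ (Fin N)) :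
    EuclideanSpace ℝ (Fin n) →L[ℝ] EuclideanSpace ℝ (Fin N) :=
  -(ContinuousLinearMap.snd ℝ (EuclideanSpace ℝ (Fin n)) (EuclideanSpace ℝ (Fin N)) ∘L
    c.dTot (c.tot.symm y) ∘L Γ.vert (c.tot.symm y) ∘L (c.dTot (c.tot.symm y)).inverse ∘L
    ContinuousLinearMap.inl ℝ (EuclideanSpace ℝ (Fin n)) (EuclideanSpace ℝ (Fin N)))

variable (c : B.AdaptedChart)

/-- The coordinate vector field `∂_i` on the base (zero outside the chart domain). -/
def AdaptedChart.frame (i : Fin n) (m : M) : TangentSpace (𝓡 n) m :=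
  (c.dBase m).inverse (EuclideanSpace.single i 1)

/-- The Christoffel symbols of a covariant derivative on `TM`: for `u ∈ ℝⁿ`, the vector
`u^μ Λ^ν_{μi}`, i.e. the coordinates of `∇_u ∂_i`. -/
def christoffel
    (Λ : CovariantDerivative (𝓡 n) (EuclideanSpace ℝ (Fin n))
      (fun m : M => TangentSpace (𝓡 n) m)) (m : M) (i : Fin n) :
    EuclideanSpace ℝ (Fin n) →L[ℝ] EuclideanSpace ℝ (Fin n) :=
  c.dBase m ∘L Λ (c.frame i) m ∘L (c.dBase m).inverse

/-- The endomorphism `w^σ ↦ u^μ Λ^ν_{μσ} w^σ` of `ℝⁿ`. -/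
def christoffelEnd
    (Λ : CovariantDerivative (𝓡 n) (EuclideanSpace ℝ (Fin n))
      (fun m : M => TangentSpace (𝓡 n) m)) (m : M) (u : EuclideanSpace ℝ (Fin n)) :
    EuclideanSpace ℝ (Fin n) →L[ℝ] EuclideanSpace ℝ (Fin n) :=
  ∑ i, (EuclideanSpace.proj i : EuclideanSpace ℝ (Fin n) →L[ℝ] ℝ).smulRight
    (christoffel c Λ m i u)

/-- The momentum components of the horizontal lift of `u` with respect to the induced connection
on `P = V^*E ⊗ TM ⊗ Λⁿ T^*M`:
`u^μ (- ∂_A Γ^B_μ p^ν_B - Λ^ν_{μσ} p^σ_A + Λ^ρ_{μρ} p^ν_A)`. -/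
def Connection.momentumCoeff
    (Λ : CovariantDerivative (𝓡 n) (EuclideanSpace ℝ (Fin n))
      (fun m : M => TangentSpace (𝓡 n) m)) (y : PhaseModel n N) :
    EuclideanSpace ℝ (Fin n) →L[ℝ]
      (EuclideanSpace ℝ (Fin N) →L[ℝ] EuclideanSpace ℝ (Fin n)) :=
  LinearMap.toContinuousLinearMap
    { toFun := fun u =>
        -(y.2 ∘L (fderiv ℝ (Γ.coeff c) y.1 ∘L
            ContinuousLinearMap.inr ℝ (EuclideanSpace ℝ (Fin n)) (EuclideanSpace ℝ (Fin N))).flip u)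
          - christoffelEnd c Λ (c.base.symm y.1.1) u ∘L y.2
          + (∑ i, christoffel c Λ (c.base.symm y.1.1) i u i) • y.2
      map_add' := fun u u' => by
        ext a i
        simp [christoffelEnd, add_mul, Finset.sum_add_distrib]
        ring
      map_smul' := fun t u => by
        ext a i
        simp only [christoffelEnd, map_smul, _root_.add_apply,
          _root_.sub_apply, _root_.neg_apply,
          ContinuousLinearMap.comp_apply, _root_.smul_apply,
          _root_.sum_apply, ContinuousLinearMap.smulRight_apply, PiLp.add_apply,
          PiLp.sub_apply, PiLp.neg_apply, PiLp.smul_apply, smul_eq_mul, RingHom.id_apply,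
          WithLp.ofLp_sum, WithLp.ofLp_smul, Finset.sum_apply, Pi.smul_apply,
          mul_left_comm _ t, ← Finset.mul_sum]
        ring }

/-- The connection `Γ̄` on `P → M` that is induced by a connection `Γ` on `E` and a connection `Λ`
on `TM`, as a horizontal lift `T_m M → T_q P`, computed in given adapted coordinates. -/
def Connection.barIn
    (Λ : CovariantDerivative (𝓡 n) (EuclideanSpace ℝ (Fin n))
      (fun m : M => TangentSpace (𝓡 n) m)) (q : B.Phase) :
    TangentSpace (𝓡 n) (B.toBase q) →L[ℝ] B.PhaseTangent q :=
  (c.dPhase q).inverse ∘L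
    (((ContinuousLinearMap.id ℝ (EuclideanSpace ℝ (Fin n))).prod
      (Γ.coeff c (c.phaseChart q).1)).prod (Γ.momentumCoeff c Λ (c.phaseChart q))) ∘L
    c.dBase (B.toBase q)

/-- The connection `Γ̄` on `P → M` induced by `Γ` and `Λ`. (The result does not depend on the
coordinates that are used at each point.) -/
def Connection.bar
    (Λ : CovariantDerivative (𝓡 n) (EuclideanSpace ℝ (Fin n))
      (fun m : M => TangentSpace (𝓡 n) m)) (q : B.Phase) :
    TangentSpace (𝓡 n) (B.toBase q) →L[ℝ] B.PhaseTangent q :=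
  Γ.barIn (B.adaptedChartAt (B.toTotal q)) Λ q

end

variable {B} in
/-- For a horizontal lift `hor` on `P → M`, the linear map whose columns are the coordinate
expressions of the frame of `TP` that consists of the lifts of the `∂_μ` and of `∂_A`,
`∂_μ^A`. It is the dual of the frame `dx^μ`, `e^A`, `e^μ_A` of `T^*P`. -/
def AdaptedChart.horFrame (c : B.AdaptedChart)
    (hor : (q : B.Phase) → TangentSpace (𝓡 n) (B.toBase q) →L[ℝ] B.PhaseTangent q)
    (y : PhaseModel n N) : PhaseModel n N →L[ℝ] PhaseModel n N :=
  vertPart n N +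
    c.dPhase (c.phaseChart.symm y) ∘L hor (c.phaseChart.symm y) ∘L
    (c.dBase (B.toBase (c.phaseChart.symm y))).inverse ∘L
    (ContinuousLinearMap.fst ℝ (EuclideanSpace ℝ (Fin n)) (EuclideanSpace ℝ (Fin N)) ∘L
      ContinuousLinearMap.fst ℝ (EuclideanSpace ℝ (Fin n) × EuclideanSpace ℝ (Fin N))
        (EuclideanSpace ℝ (Fin N) →L[ℝ] EuclideanSpace ℝ (Fin n)))

variable {B} in
/-- The vertical differential in adapted coordinates. A form is expanded in the frame `dx^μ`,
`e^A`, `e^μ_A` and the differential is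
`d(f dx ∧ … ∧ e ∧ …) = (∂_A f e^A + ∂_μ^A f e^μ_A) ∧ dx ∧ … ∧ e ∧ …`. -/
def PhaseForm.vertDiffIn {r : ℕ}
    (hor : (q : B.Phase) → TangentSpace (𝓡 n) (B.toBase q) →L[ℝ] B.PhaseTangent q)
    (α : B.PhaseForm r) (c : B.AdaptedChart) (q : B.Phase) :
    B.PhaseTangent q [⋀^Fin (r + 1)]→L[ℝ] ℝ :=
  (ContinuousAlternatingMap.alternatizeUncurryFin
    (fderiv ℝ (fun y => (α.inChart c y).compContinuousLinearMap (c.horFrame hor y))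
      (c.phaseChart q) ∘L vertPart n N)).compContinuousLinearMap
    ((c.horFrame hor (c.phaseChart q)).inverse ∘L c.dPhase q)

variable {B} in
/-- The vertical differential `d_Γ̄` of forms on `P`, for a connection on `P → M` that is given by
its horizontal lift. (The result does not depend on the coordinates used at each point.) -/
def PhaseForm.vertDiff {r : ℕ}
    (hor : (q : B.Phase) → TangentSpace (𝓡 n) (B.toBase q) →L[ℝ] B.PhaseTangent q)
    (α : B.PhaseForm r) : B.PhaseForm (r + 1) :=
  fun q => α.vertDiffIn hor (B.adaptedChartAt (B.toTotal q)) q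

section

variable [IsManifold (𝓡 (n + N)) ∞ E]

/-- Smooth `π`-vertical vector fields on `E`. -/
def IsVerticalField (X : (e : E) → TangentSpace (𝓡 (n + N)) e) : Prop :=
  ContMDiff (𝓡 (n + N)) (𝓡 (n + N)).tangent ∞
      (fun e => (⟨e, X e⟩ : TangentBundle (𝓡 (n + N)) E)) ∧
    ∀ e, X e ∈ B.VertAt e

variable {B} in
/-- The components `X^A` in adapted coordinates of a vector field on `E`. -/
def AdaptedChart.component (c : B.AdaptedChart) (X : (e : E) → TangentSpace (𝓡 (n + N)) e)
    (y : EuclideanSpace ℝ (Fin n) × EuclideanSpace ℝ (Fin N)) : EuclideanSpace ℝ (Fin N) :=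
  (c.dTot (c.tot.symm y) (X (c.tot.symm y))).2

/-- `Xh` is the canonical lift to `P` of the vertical vector field `X` on `E`, that is, the
generator of the flow `(e, α ⊗ ω) ↦ (φ_t e, (α ∘ (V φ_t)⁻¹) ⊗ ω)` on `P`, where `φ_t` is the flow
of `X`: in all adapted coordinates, `Xh = X^A ∂_A - p^ν_B (∂_A X^B) ∂_ν^A`. -/
def IsCanonicalLift (X : (e : E) → TangentSpace (𝓡 (n + N)) e) (Xh : B.PhaseField) : Prop :=
  ∀ (c : B.AdaptedChart) (q : B.Phase), q ∈ c.phaseChart.source →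
    c.dPhase q (Xh q) =
      ((0, c.component X (c.phaseChart q).1),
        -((c.phaseChart q).2 ∘L fderiv ℝ (c.component X) (c.phaseChart q).1 ∘L
          ContinuousLinearMap.inr ℝ (EuclideanSpace ℝ (Fin n)) (EuclideanSpace ℝ (Fin N))))

end

end SmoothFibreBundle

namespace SmoothFibreBundle

variable {k N : ℕ} {M E F : Type*}
  [TopologicalSpace M] [ChartedSpace (EuclideanSpace ℝ (Fin (k + 1))) M]
  [TopologicalSpace E] [ChartedSpace (EuclideanSpace ℝ (Fin (k + 1 + N))) E]
  [TopologicalSpace F] [ChartedSpace (EuclideanSpace ℝ (Fin N)) F]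
  [IsManifold (𝓡 (k + 1)) ∞ M] [IsManifold (𝓡 N) ∞ F] [IsManifold (𝓡 (k + 1 + N)) ∞ E]
  {B : SmoothFibreBundle (k + 1) N M E F} (Γ : B.Connection)

/-- For `q = α ⊗ ω`, the multilinear map
`(X_1, …, X_n) ↦ ω (α (P_Γ (T(π^1_0)^⋆ X_1)), T(π_1)^⋆ X_2, …, T(π_1)^⋆ X_n)`, antisymmetrized
with the factor `1 / n!`, where `n = k + 1`. -/
def Connection.thetaPure (q : B.Phase)
    (α : B.VertAt (B.toTotal q) →L[ℝ] TangentSpace (𝓡 (k + 1)) (B.toBase q))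
    (η : TangentSpace (𝓡 (k + 1)) (B.toBase q) [⋀^Fin (k + 1)]→L[ℝ] ℝ) :
    B.PhaseTangent q [⋀^Fin (k + 1)]→L[ℝ] ℝ :=
  ((k + 1).factorial : ℝ)⁻¹ • ContinuousMultilinearMap.alternatization
    (η.toContinuousMultilinearMap.compContinuousLinearMap
      (Fin.cons (α ∘L Γ.toVert (B.toTotal q) ∘L B.tangentToTotal q)
        (fun _ : Fin k => B.tangentToBase q)))

theorem Connection.thetaPure_apply (q : B.Phase)
    (α : B.VertAt (B.toTotal q) →L[ℝ] TangentSpace (𝓡 (k + 1)) (B.toBase q))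
    (η : TangentSpace (𝓡 (k + 1)) (B.toBase q) [⋀^Fin (k + 1)]→L[ℝ] ℝ)
    (v : Fin (k + 1) → B.PhaseTangent q) :
    Γ.thetaPure q α η v = ∑ σ : Equiv.Perm (Fin (k + 1)),
      (((Equiv.Perm.sign σ : ℤ) : ℝ) / ((k + 1).factorial : ℝ)) *
        η (Fin.cons (α (Γ.toVert (B.toTotal q) (B.tangentToTotal q (v (σ 0)))))
          (fun i : Fin k => B.tangentToBase q (v (σ i.succ)))) := by
  simp only [thetaPure, ContinuousAlternatingMap.smul_apply,
    ContinuousMultilinearMap.alternatization_apply_apply, Finset.smul_sum]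
  refine Finset.sum_congr rfl fun σ _ => ?_
  have h : (fun i : Fin (k + 1) => (Fin.cons (α ∘L Γ.toVert (B.toTotal q) ∘L B.tangentToTotal q)
        (fun _ : Fin k => B.tangentToBase q) : Fin (k + 1) → B.PhaseTangent q →L[ℝ]
          TangentSpace (𝓡 (k + 1)) (B.toBase q)) i ((v ∘ σ) i)) =
      Fin.cons (α (Γ.toVert (B.toTotal q) (B.tangentToTotal q (v (σ 0)))))
          (fun i : Fin k => B.tangentToBase q (v (σ i.succ))) := by
    funext i
    refine Fin.cases ?_ (fun j => ?_) i
    · rfl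
    · rfl
  rw [ContinuousMultilinearMap.compContinuousLinearMap_apply, h, Units.smul_def, zsmul_eq_mul,
    smul_eq_mul, div_eq_inv_mul, mul_assoc]
  rfl

/-- The canonical `n`-form `Θ_Γ` on `P`, `n = k + 1`. -/
def Connection.theta : B.PhaseForm (k + 1) := fun q =>
  TensorProduct.lift (LinearMap.mk₂ ℝ (Γ.thetaPure q)
    (by
      intro α α' η
      ext v
      simp only [ContinuousAlternatingMap.add_apply, thetaPure_apply,
        _root_.add_apply, ContinuousAlternatingMap.cons_add, mul_add,
        Finset.sum_add_distrib])
    (by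
      intro t α η
      ext v
      simp only [ContinuousAlternatingMap.smul_apply, thetaPure_apply,
        _root_.smul_apply, ContinuousAlternatingMap.cons_smul, smul_eq_mul, Finset.mul_sum]
      exact Finset.sum_congr rfl fun σ _ => mul_left_comm _ _ _)
    (by
      intro α η η'
      ext v
      simp only [ContinuousAlternatingMap.add_apply, thetaPure_apply, mul_add,
        Finset.sum_add_distrib])
    (by
      intro t α η
      ext v
      simp only [ContinuousAlternatingMap.smul_apply, thetaPure_apply, smul_eq_mul,
        Finset.mul_sum]
      exact Finset.sum_congr rfl fun σ _ => mul_left_comm _ _ _)) q.2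

variable (Λ : CovariantDerivative (𝓡 (k + 1)) (EuclideanSpace ℝ (Fin (k + 1)))
  (fun m : M => TangentSpace (𝓡 (k + 1)) m))

/-- The polysymplectic `(n+1)`-form `Ω_Γ = - d_Γ̄ Θ_Γ`, `n = k + 1`. -/
def Connection.omega : B.PhaseForm (k + 1 + 1) := -(Γ.theta.vertDiff (Γ.bar Λ))

/-- `X` is a Hamiltonian `1`-vector field with Hamiltonian `(n-1)`-form `H`, `n = k + 1`: both are
smooth, `H` is horizontal, and `d_Γ̄ H = X ⌟ Ω_Γ`. -/
def Connection.IsHamiltonianFor (H : B.PhaseForm k) (X : B.PhaseField) : Prop :=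
  B.IsSmoothField X ∧ H.IsSmooth ∧ H.IsHorizontal ∧
    H.vertDiff (Γ.bar Λ) = (Γ.omega Λ).contract X

/-- `X` is a Hamiltonian `1`-vector field. -/
def Connection.IsHamiltonian (X : B.PhaseField) : Prop :=
  ∃ H : B.PhaseForm k, Γ.IsHamiltonianFor Λ H X

end SmoothFibreBundle

end

/-! Everything is computed in the frame `dx^μ`, `e^A`, `e^μ_A`. Since all arguments but one of Θ_Γ
are alternating, the antisymmetrization over `n!` permutations collapses to `n` terms, and in the
frame Θ_Γ = (1/n) p^μ_A e^A ∧ (∂_μ ⌟ dⁿx): linear in `p`, with constant coefficients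
(`Connection.theta_inChart_comp_horFrame`). Hence Ω_Γ has constant coefficients in the frame. A
horizontal form has the same coefficients in the frame as in the chart. So the equation d_Γ̄ H = X ⌟
Ω_Γ becomes an identity of alternating forms on the model space
(`PhaseForm.IsHorizontal.vertDiff_eq_contract_iff`). About Γ̄ one needs only that it is a lift of
vectors of `M` and that its image in `TE` is Γ-horizontal.

For (a), insert a momentum direction `s` into the equation; this expresses the derivative of H along
`s` through Θ at momentum `s`, contracted with X (`fderiv_inChart_momentum`). If n ≥ 2, H has a slot
for a further vector ∂_A, which kills the left side by horizontality; the right side then forces X^μ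
= 0 (`base_eq_zero_of_momentum`). What remains is, up to sign, ∂H^μ/∂p^ν_A = (1/n) δ^μ_ν X^A. So
H^μ, and with it X^A, depends only on the μ-th row of `p`; with two different μ available, X^A does
not depend on `p` at all (`eq_of_hasFDerivAt_apply`). This gives a field on `E`.

For (b), the coordinate formula of the lift is chart independent because differentiating the
transformation laws of X^A and of p^μ_A yields the same second derivative of the coordinate change,
by its symmetry (`fderiv_canonicalLift_momentum`). In coordinates I(X) = (1/n) p^μ_A X^A ∂_μ ⌟ dⁿx,
and the two summands of its differential given by the product rule are the two summands of X̂ ⌟ Ω_Γ.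
-/

set_option linter.unusedSectionVars false

/-! ### Permutation sums, determinants, and functions of the momenta. -/

noncomputable section

/-- Summing over permutations `σ` of `Fin (k + 1)` an expression that is alternating in
`σ 1, …, σ k` gives `k!` times a sum over the value of `σ 0`. -/
theorem sum_perm_fin_succ_of_alternating {k : ℕ} (G : Fin (k + 1) → (Fin k → Fin (k + 1)) → ℝ)
    (hG : ∀ i f (τ : Equiv.Perm (Fin k)), G i (f ∘ τ) = ((Equiv.Perm.sign τ : ℤ) : ℝ) * G i f) :
    ∑ σ : Equiv.Perm (Fin (k + 1)), ((Equiv.Perm.sign σ : ℤ) : ℝ) * G (σ 0) (σ ∘ Fin.succ) =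
      (k.factorial : ℝ) * ∑ i : Fin (k + 1), (-1 : ℝ) ^ (i : ℕ) * G i i.succAbove := by
  -- A permutation is recorded as `i = σ 0` together with a permutation `τ` of the other `k` places;
  -- the summand turns out not to depend on `τ`, which produces the factor `k!`.
  rw [Finset.univ_perm_fin_succ, ← Finset.univ_product_univ]
  simp only [Finset.sum_map, Equiv.toEmbedding_apply, Finset.sum_product, Finset.mul_sum]
  refine Finset.sum_congr rfl fun i _ => ?_
  have key : ∀ τ : Equiv.Perm (Fin k),
      ((Equiv.Perm.sign (Equiv.Perm.decomposeFin.symm (i, τ)) : ℤ) : ℝ) *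
        G (Equiv.Perm.decomposeFin.symm (i, τ) 0)
          (Equiv.Perm.decomposeFin.symm (i, τ) ∘ Fin.succ) =
      (-1 : ℝ) ^ (i : ℕ) * G i i.succAbove := by
    intro τ
    have hsq : ((Equiv.Perm.sign τ : ℤ) : ℝ) * ((Equiv.Perm.sign τ : ℤ) : ℝ) = 1 := by
      rw [← Int.cast_mul, ← Units.val_mul, Int.units_mul_self]; simp
    refine Fin.cases ?_ (fun i => ?_) i
    · have h : (Equiv.Perm.decomposeFin.symm ((0 : Fin (k + 1)), τ) ∘ Fin.succ) =
          (0 : Fin (k + 1)).succAbove ∘ τ := by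
        funext j; simp [Equiv.Perm.decomposeFin_symm_apply_succ]
      rw [h, hG, Equiv.Perm.decomposeFin_symm_apply_zero, Equiv.Perm.decomposeFin.symm_sign,
        if_pos rfl, ← mul_assoc, one_mul, hsq]
      simp
    · obtain ⟨m, rfl⟩ : ∃ m, k = m + 1 := ⟨k - 1, by have := i.pos; omega⟩
      -- The transposition of `0` and `i.succ` does not list the remaining values in increasing
      -- order. Comparison with `succAbove` costs the cycle `i.cycleRange`, of sign `(-1)^i`; with
      -- the sign of the transposition this gives `(-1)^(i+1)`.
      have h : (Equiv.Perm.decomposeFin.symm (i.succ, τ) ∘ Fin.succ) =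
          i.succ.succAbove ∘ (τ.trans i.cycleRange) := by
        funext j
        simp [Equiv.Perm.decomposeFin_symm_apply_succ, Fin.succAbove_cycleRange]
      have hs : ((Equiv.Perm.sign (τ.trans i.cycleRange) : ℤ) : ℝ) =
          (-1) ^ (i : ℕ) * ((Equiv.Perm.sign τ : ℤ) : ℝ) := by
        rw [Equiv.Perm.sign_trans, Fin.sign_cycleRange]; simp
      rw [h, hG, hs, Equiv.Perm.decomposeFin_symm_apply_zero, Equiv.Perm.decomposeFin.symm_sign,
        if_neg (Fin.succ_ne_zero i)]
      push_cast
      rw [Fin.val_succ, pow_succ]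
      linear_combination ((-1) ^ (i : ℕ) * (-1) * G i.succ i.succ.succAbove) * hsq
  simp only [key, Finset.sum_const, Finset.card_univ, Fintype.card_perm, Fintype.card_fin,
    nsmul_eq_mul]

namespace SmoothFibreBundle

theorem stdVol_update_single (n : ℕ) (i : Fin n) (x : EuclideanSpace ℝ (Fin n)) :
    stdVol n (Function.update (fun i => EuclideanSpace.single i (1 : ℝ)) i x) = x i := by
  classical
  have hx : x = ∑ j, x j • EuclideanSpace.single j (1 : ℝ) := by
    ext l; simp [Finset.sum_apply, Pi.single_apply]
  conv_lhs => rw [hx]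
  rw [← ContinuousAlternatingMap.coe_toAlternatingMap, AlternatingMap.map_update_sum]
  simp only [ContinuousAlternatingMap.coe_toAlternatingMap]
  rw [Finset.sum_eq_single i]
  · rw [ContinuousAlternatingMap.map_update_smul]
    have : Function.update (fun i => EuclideanSpace.single i (1 : ℝ)) i
        (EuclideanSpace.single i (1 : ℝ)) = fun i : Fin n => EuclideanSpace.single i (1 : ℝ) :=
      Function.update_eq_self _ _
    rw [this, stdVol_single]; simp
  · intro j _ hj
    rw [ContinuousAlternatingMap.map_update_smul,
      (stdVol n).map_eq_zero_of_eq _ (i := i) (j := j) (by simp [hj]) hj.symm, smul_zero]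
  · simp

/-- Moving `x` from the front to the `i`-th slot costs `(-1)^i` and leaves the standard basis with
its `i`-th vector replaced. This reads off the components of an `(n-1)`-form `a ⌟ dⁿx`. -/
theorem stdVol_cons_single {k : ℕ} (i : Fin (k + 1)) (x : EuclideanSpace ℝ (Fin (k + 1))) :
    stdVol (k + 1) (Fin.cons x fun j => EuclideanSpace.single (i.succAbove j) (1 : ℝ)) =
      (-1) ^ (i : ℕ) * x i := by
  have h := (stdVol (k + 1)).toAlternatingMap.neg_one_pow_smul_map_insertNth i x
    (fun j => EuclideanSpace.single (i.succAbove j) (1 : ℝ))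
  have h2 : i.insertNth (α := fun _ => EuclideanSpace ℝ (Fin (k + 1))) x
      (fun j => EuclideanSpace.single (i.succAbove j) (1 : ℝ)) =
      Function.update (fun i => EuclideanSpace.single i (1 : ℝ)) i x := by
    rw [← Fin.insertNth_removeNth]; rfl
  rw [h2] at h
  refine h.symm.trans ?_
  change (-1) ^ (i : ℕ) • stdVol (k + 1) _ = _
  rw [stdVol_update_single]
  simp

theorem eq_zero_of_stdVol_eq_zero {n : ℕ} (i : Fin n) (x : EuclideanSpace ℝ (Fin n))
    (h : ∀ v : Fin n → EuclideanSpace ℝ (Fin n), v i = x → stdVol n v = 0) : x = 0 := by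
  ext j
  rw [← stdVol_update_single n j x]
  -- The `j`-th coordinate of `x` is seen with `x` in slot `j`; the swap brings `x` to the
  -- prescribed slot `i`.
  have h1 := h (Function.update (fun i => EuclideanSpace.single i (1 : ℝ)) j x ∘ Equiv.swap i j)
    (by simp)
  have h2 := (stdVol n).toAlternatingMap.map_perm
    (Function.update (fun i => EuclideanSpace.single i (1 : ℝ)) j x) (Equiv.swap i j)
  have h3 := h2.symm.trans h1
  rwa [smul_eq_zero_iff_eq] at h3

/-- If the components of `s ↦ s (ξ p)` are, up to non-zero factors, partial derivatives of
functions of `p ∈ Hom(V, ℝⁿ)` and `n ≥ 2`, then `ξ` is constant. -/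
theorem eq_of_hasFDerivAt_apply {k N : ℕ} (hk : 1 ≤ k)
    (ξ : (EuclideanSpace ℝ (Fin N) →L[ℝ] EuclideanSpace ℝ (Fin (k + 1))) →
      EuclideanSpace ℝ (Fin N))
    (g : Fin (k + 1) → (EuclideanSpace ℝ (Fin N) →L[ℝ] EuclideanSpace ℝ (Fin (k + 1))) → ℝ)
    (hg : ∀ i p, DifferentiableAt ℝ (g i) p) (c : Fin (k + 1) → ℝ) (hc : ∀ i, c i ≠ 0)
    (hgξ : ∀ i p s, fderiv ℝ (g i) p s = c i * (s (ξ p)) i)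
    (p p' : EuclideanSpace ℝ (Fin N) →L[ℝ] EuclideanSpace ℝ (Fin (k + 1))) : ξ p = ξ p' := by
  classical
  have step : ∀ (i : Fin (k + 1)) (s p : EuclideanSpace ℝ (Fin N) →L[ℝ]
      EuclideanSpace ℝ (Fin (k + 1))), (∀ x, (s x) i = 0) → ξ (p + s) = ξ p := by
    intro i s p hs
    have hconst : ∀ p, g i (p + s) = g i p := by
      intro p
      have hd : ∀ t : ℝ, HasDerivAt (fun t : ℝ => g i (p + t • s)) 0 t := by
        intro t
        have h1 : HasDerivAt (fun t : ℝ => p + t • s) s t := by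
          simpa using ((hasDerivAt_id t).smul_const s).const_add p
        have h2 := (hg i (p + t • s)).hasFDerivAt.comp_hasDerivAt t h1
        rwa [hgξ, hs, mul_zero] at h2
      have h := is_const_of_deriv_eq_zero (fun t => (hd t).differentiableAt)
        (fun t => (hd t).deriv) 1 0
      have h0 : p + (0 : ℝ) • s = p := by ext; simp
      have h1 : p + (1 : ℝ) • s = p + s := by rw [one_smul]
      rwa [h0, h1] at h
    -- `g i` is invariant under translation by `s`, hence so is its derivative, which determines
    -- `ξ`. First derivatives suffice.
    have hD : fderiv ℝ (g i) (p + s) = fderiv ℝ (g i) p := by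
      have : g i = fun p => g i (p + s) := funext fun p => (hconst p).symm
      conv_rhs => rw [this]
      rw [fderiv_comp_add_right]
    ext a
    have h := congrArg (fun f => f ((EuclideanSpace.proj a :
      EuclideanSpace ℝ (Fin N) →L[ℝ] ℝ).smulRight (EuclideanSpace.single i (1 : ℝ)))) hD
    simpa [hgξ, hc i] using h
  -- `p - p'` is split into its rows, added one at a time: the `i`-th row has zero `j`-th component
  -- for any `j ≠ i`, so `step j` applies. Such a `j` exists because `n ≥ 2`.
  let row : Fin (k + 1) → EuclideanSpace ℝ (Fin N) →L[ℝ] EuclideanSpace ℝ (Fin (k + 1)) :=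
    fun i => ((EuclideanSpace.proj i : EuclideanSpace ℝ (Fin (k + 1)) →L[ℝ] ℝ) ∘L
      (p - p')).smulRight (EuclideanSpace.single i (1 : ℝ))
  have hrow : p = p' + ∑ i, row i := by
    ext a i
    simp [row, Pi.single_apply]
  have hsum : ∀ S : Finset (Fin (k + 1)), ξ (p' + ∑ i ∈ S, row i) = ξ p' := by
    intro S
    induction S using Finset.induction_on with
    | empty => simp
    | insert i S hi ih =>
      have : Nontrivial (Fin (k + 1)) := Fin.nontrivial_iff_two_le.2 (by omega)
      obtain ⟨j, hj⟩ := exists_ne i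
      rw [Finset.sum_insert hi, add_comm (row i), ← add_assoc, step j _ _ (fun x => by
        simp [row, hj]), ih]
  rw [hrow, hsum]

end SmoothFibreBundle

end

/-! ### Differentials of the charts of `P` and of its projections. -/

noncomputable section

namespace SmoothFibreBundle

variable {n N : ℕ} {M E F : Type*}
  [TopologicalSpace M] [ChartedSpace (EuclideanSpace ℝ (Fin n)) M]
  [TopologicalSpace E] [ChartedSpace (EuclideanSpace ℝ (Fin (n + N))) E]
  [TopologicalSpace F] [ChartedSpace (EuclideanSpace ℝ (Fin N)) F]
  [IsManifold (𝓡 n) ∞ M] [IsManifold (𝓡 N) ∞ F]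
  {B : SmoothFibreBundle n N M E F}

namespace AdaptedChart

variable (c : B.AdaptedChart)

theorem snd_phaseChart {q : B.Phase} (hq : B.toTotal q ∈ c.tot.source) :
    (c.phaseChart q).2 = c.fibreEquiv hq q.2 := dif_pos hq

theorem phaseChart_mem_atlas : c.phaseChart ∈ atlas (PhaseModel n N) B.Phase :=
  mem_iUnion₂.2 ⟨c.phaseEquiv, mem_range_self c, rfl⟩

theorem phaseChart_mdifferentiable :
    c.phaseChart.MDifferentiable 𝓘(ℝ, PhaseModel n N) 𝓘(ℝ, PhaseModel n N) :=
  ⟨mdifferentiableOn_atlas c.phaseChart_mem_atlas,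
    mdifferentiableOn_atlas_symm c.phaseChart_mem_atlas⟩

theorem contMDiffOn_phaseChart :
    ContMDiffOn 𝓘(ℝ, PhaseModel n N) 𝓘(ℝ, PhaseModel n N) ∞ c.phaseChart c.phaseChart.source :=
  contMDiffOn_of_mem_maximalAtlas (IsManifold.subset_maximalAtlas c.phaseChart_mem_atlas)

theorem contMDiffOn_phaseChart_symm :
    ContMDiffOn 𝓘(ℝ, PhaseModel n N) 𝓘(ℝ, PhaseModel n N) ∞ c.phaseChart.symm
      c.phaseChart.target :=
  contMDiffOn_symm_of_mem_maximalAtlas (IsManifold.subset_maximalAtlas c.phaseChart_mem_atlas)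

/-- The isomorphism `T_q P ≅ (ℝⁿ × ℝᴺ) × Hom(ℝᴺ, ℝⁿ)`, given by the coordinates. -/
def dPhaseEquiv {q : B.Phase} (hq : q ∈ c.phaseChart.source) :
    B.PhaseTangent q ≃L[ℝ] PhaseModel n N :=
  c.phaseChart_mdifferentiable.mfderiv hq

theorem dPhaseEquiv_apply {q : B.Phase} (hq : q ∈ c.phaseChart.source) (v : B.PhaseTangent q) :
    c.dPhaseEquiv hq v = c.dPhase q v := rfl

theorem coe_dPhaseEquiv {q : B.Phase} (hq : q ∈ c.phaseChart.source) :
    (c.dPhaseEquiv hq : B.PhaseTangent q →L[ℝ] PhaseModel n N) = c.dPhase q := rfl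

theorem inverse_dPhase {q : B.Phase} (hq : q ∈ c.phaseChart.source) :
    (c.dPhase q).inverse = (c.dPhaseEquiv hq).symm := by
  rw [← c.coe_dPhaseEquiv hq, ContinuousLinearMap.inverse_equiv]

theorem dPhase_inverse_apply {q : B.Phase} (hq : q ∈ c.phaseChart.source) (w : PhaseModel n N) :
    c.dPhase q ((c.dPhase q).inverse w) = w := by
  rw [c.inverse_dPhase hq]
  exact (c.dPhaseEquiv hq).apply_symm_apply w

theorem inverse_dPhase_apply {q : B.Phase} (hq : q ∈ c.phaseChart.source) (v : B.PhaseTangent q) :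
    (c.dPhase q).inverse (c.dPhase q v) = v := by
  rw [c.inverse_dPhase hq]
  exact (c.dPhaseEquiv hq).symm_apply_apply v

theorem mfderiv_phaseChart_symm {y : PhaseModel n N} (hy : y ∈ c.phaseChart.target) :
    (mfderiv 𝓘(ℝ, PhaseModel n N) 𝓘(ℝ, PhaseModel n N) c.phaseChart.symm y :
      PhaseModel n N →L[ℝ] B.PhaseTangent (c.phaseChart.symm y)) =
      (c.dPhase (c.phaseChart.symm y)).inverse := by
  rw [c.inverse_dPhase (c.phaseChart.map_target hy)]
  refine ContinuousLinearMap.ext fun w => ?_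
  refine ((c.dPhaseEquiv (c.phaseChart.map_target hy)).eq_symm_apply).2 ?_
  exact congrArg (fun f => f w) (c.phaseChart_mdifferentiable.comp_symm_deriv hy)

/-- The isomorphism `T_m M ≅ ℝⁿ`, given by the coordinates, at the image `m` of a point of `P`. -/
def dBaseEquiv {q : B.Phase} (hq : q ∈ c.phaseChart.source) :
    TangentSpace (𝓡 n) (B.toBase q) ≃L[ℝ] EuclideanSpace ℝ (Fin n) :=
  c.baseEquiv (e := B.toTotal q) hq

theorem coe_dBaseEquiv {q : B.Phase} (hq : q ∈ c.phaseChart.source) :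
    (c.dBaseEquiv hq : TangentSpace (𝓡 n) (B.toBase q) →L[ℝ] EuclideanSpace ℝ (Fin n)) =
      c.dBase (B.toBase q) := rfl

theorem inverse_dBase {q : B.Phase} (hq : q ∈ c.phaseChart.source) :
    (c.dBase (B.toBase q)).inverse = (c.dBaseEquiv hq).symm := by
  rw [← c.coe_dBaseEquiv hq, ContinuousLinearMap.inverse_equiv]

theorem coe_totEquiv {e : E} (he : e ∈ c.tot.source) :
    (c.totEquiv he : TangentSpace (𝓡 (n + N)) e →L[ℝ]
      EuclideanSpace ℝ (Fin n) × EuclideanSpace ℝ (Fin N)) = c.dTot e := rfl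

theorem inverse_dTot {e : E} (he : e ∈ c.tot.source) :
    (c.dTot e).inverse = (c.totEquiv he).symm := by
  rw [← c.coe_totEquiv he, ContinuousLinearMap.inverse_equiv]

theorem contMDiffOn_toTotal :
    ContMDiffOn 𝓘(ℝ, PhaseModel n N) (𝓡 (n + N)) ∞ B.toTotal c.phaseChart.source := by
  have h : ContMDiffOn 𝓘(ℝ, PhaseModel n N) (𝓡 (n + N)) ∞
      (fun q => c.tot.symm (c.phaseChart q).1) c.phaseChart.source :=
    c.tot_symm_smooth.comp (contDiff_fst.contMDiff.comp_contMDiffOn c.contMDiffOn_phaseChart)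
      fun q hq => c.tot.map_source hq
  exact h.congr fun q hq => (c.tot.left_inv hq).symm

end AdaptedChart

theorem mem_phaseChart_adaptedChartAt (q : B.Phase) :
    q ∈ (B.adaptedChartAt (B.toTotal q)).phaseChart.source := B.mem_adaptedChartAt (B.toTotal q)

theorem contMDiff_toTotal : ContMDiff 𝓘(ℝ, PhaseModel n N) (𝓡 (n + N)) ∞ B.toTotal := fun q =>
  (B.adaptedChartAt (B.toTotal q)).contMDiffOn_toTotal.contMDiffAt
    ((B.adaptedChartAt (B.toTotal q)).phaseChart.open_source.mem_nhds
      (mem_phaseChart_adaptedChartAt q))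

theorem tangentToBase_apply (q : B.Phase) (v : B.PhaseTangent q) :
    B.tangentToBase q v = B.tangentProj (B.toTotal q) (B.tangentToTotal q v) := by
  have h := mfderiv_comp q
    (B.contMDiff_proj.mdifferentiableAt (x := B.toTotal q) (by simp))
    ((contMDiff_toTotal (B := B)).mdifferentiableAt (x := q) (by simp))
  exact congrArg (fun f => f v) h

namespace AdaptedChart

variable (c : B.AdaptedChart)

theorem totEquiv_tangentToTotal {q : B.Phase} (hq : B.toTotal q ∈ c.tot.source)
    (v : B.PhaseTangent q) :
    c.totEquiv hq (B.tangentToTotal q v) = (c.dPhase q v).1 := by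
  have h1 := (c.tot_mdifferentiable.mdifferentiableAt hq).hasMFDerivAt.comp q
    ((contMDiff_toTotal (B := B)).mdifferentiableAt (x := q) (by simp)).hasMFDerivAt
  have h2 : HasMFDerivAt 𝓘(ℝ, PhaseModel n N)
      𝓘(ℝ, EuclideanSpace ℝ (Fin n) × EuclideanSpace ℝ (Fin N))
      (Prod.fst : PhaseModel n N → _) (c.phaseChart q)
      (ContinuousLinearMap.fst ℝ (EuclideanSpace ℝ (Fin n) × EuclideanSpace ℝ (Fin N))
        (EuclideanSpace ℝ (Fin N) →L[ℝ] EuclideanSpace ℝ (Fin n))) :=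
    hasFDerivAt_fst.hasMFDerivAt
  have h3 := h2.comp q (c.phaseChart_mdifferentiable.mdifferentiableAt hq).hasMFDerivAt
  exact congrArg (fun f => f v) (hasMFDerivAt_unique h1 h3)

theorem dBaseEquiv_tangentToBase {q : B.Phase} (hq : q ∈ c.phaseChart.source)
    (v : B.PhaseTangent q) :
    c.dBaseEquiv hq (B.tangentToBase q v) = (c.dPhase q v).1.1 := by
  rw [tangentToBase_apply, ← totEquiv_tangentToTotal c hq]
  exact (fst_totEquiv c (e := B.toTotal q) hq _).symm

theorem tangentToBase_inverse_dPhase {q : B.Phase} (hq : q ∈ c.phaseChart.source)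
    (w : PhaseModel n N) :
    B.tangentToBase q ((c.dPhase q).inverse w) = (c.dBaseEquiv hq).symm w.1.1 := by
  rw [ContinuousLinearEquiv.eq_symm_apply, dBaseEquiv_tangentToBase c hq,
    dPhase_inverse_apply c hq]

theorem tangentToTotal_inverse_dPhase {q : B.Phase} (hq : B.toTotal q ∈ c.tot.source)
    (w : PhaseModel n N) :
    B.tangentToTotal q ((c.dPhase q).inverse w) = (c.totEquiv hq).symm w.1 := by
  rw [ContinuousLinearEquiv.eq_symm_apply, totEquiv_tangentToTotal c hq,
    dPhase_inverse_apply c hq]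

end AdaptedChart
end SmoothFibreBundle

end

/-! ### Model expressions of Θ_Γ and of its vertical differential. -/

noncomputable section

namespace SmoothFibreBundle

theorem vertPart_apply {n N : ℕ} (w : PhaseModel n N) :
    vertPart n N w = ((0, w.1.2), w.2) := rfl

/-- The projection `(u, w, s) ↦ u`. -/
def baseCoord (n N : ℕ) : PhaseModel n N →L[ℝ] EuclideanSpace ℝ (Fin n) :=
  ContinuousLinearMap.fst ℝ (EuclideanSpace ℝ (Fin n)) (EuclideanSpace ℝ (Fin N)) ∘L
    ContinuousLinearMap.fst ℝ (EuclideanSpace ℝ (Fin n) × EuclideanSpace ℝ (Fin N))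
      (EuclideanSpace ℝ (Fin N) →L[ℝ] EuclideanSpace ℝ (Fin n))

/-- The `k`-form `(k + 1)⁻¹ a ⌟ d^{k+1}x`, for `a ∈ ℝ^{k+1}`. -/
def hamStd (k N : ℕ) :
    EuclideanSpace ℝ (Fin (k + 1)) →L[ℝ] PhaseModel (k + 1) N [⋀^Fin k]→L[ℝ] ℝ :=
  ((k + 1 : ℕ) : ℝ)⁻¹ • (ContinuousAlternatingMap.compContinuousLinearMapCLM
    (baseCoord (k + 1) N) ∘L (stdVol (k + 1)).curryLeft)

theorem hamStd_apply {k N : ℕ} (a : EuclideanSpace ℝ (Fin (k + 1)))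
    (v : Fin k → PhaseModel (k + 1) N) :
    hamStd k N a v =
      ((k + 1 : ℕ) : ℝ)⁻¹ * stdVol (k + 1) (Fin.cons a fun j => (v j).1.1) := rfl

theorem hamStd_eq_zero {k N : ℕ} (a : EuclideanSpace ℝ (Fin (k + 1)))
    {v : Fin k → PhaseModel (k + 1) N} (i : Fin k) (h : (v i).1.1 = 0) : hamStd k N a v = 0 := by
  rw [hamStd_apply, (stdVol (k + 1)).map_coord_zero i.succ (by simpa using h), mul_zero]

/-- The coordinate expression of `Θ_Γ` in the frame `dx^μ`, `e^A`, `e^μ_A`. -/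
def thetaStd (k N : ℕ) : (EuclideanSpace ℝ (Fin N) →L[ℝ] EuclideanSpace ℝ (Fin (k + 1))) →L[ℝ]
    PhaseModel (k + 1) N [⋀^Fin (k + 1)]→L[ℝ] ℝ :=
  LinearMap.toContinuousLinearMap
    { toFun := fun p => ContinuousAlternatingMap.alternatizeUncurryFin (hamStd k N ∘L p ∘L
        ContinuousLinearMap.snd ℝ _ _ ∘L ContinuousLinearMap.fst ℝ _ _)
      map_add' := fun p p' => by
        rw [← ContinuousAlternatingMap.alternatizeUncurryFin_add]
        simp only [ContinuousLinearMap.add_comp, ContinuousLinearMap.comp_add]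
      map_smul' := fun t p => by
        rw [RingHom.id_apply, ← ContinuousAlternatingMap.alternatizeUncurryFin_smul]
        simp only [ContinuousLinearMap.smul_comp, ContinuousLinearMap.comp_smul] }

theorem thetaStd_apply {k N : ℕ}
    (p : EuclideanSpace ℝ (Fin N) →L[ℝ] EuclideanSpace ℝ (Fin (k + 1)))
    (v : Fin (k + 1) → PhaseModel (k + 1) N) :
    thetaStd k N p v = ∑ i : Fin (k + 1), (-1 : ℝ) ^ (i : ℕ) *
      hamStd k N (p (v i).1.2) (i.removeNth v) := by
  refine (ContinuousAlternatingMap.alternatizeUncurryFin_apply _ _).trans ?_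
  simp [ContinuousLinearMap.comp_apply]

/-- The vector `x` has no base component, so it annihilates every term in which it is fed to `dⁿx`;
only the term in which it is paired with `p` is left. -/
theorem thetaStd_cons {k N : ℕ}
    (p : EuclideanSpace ℝ (Fin N) →L[ℝ] EuclideanSpace ℝ (Fin (k + 1)))
    (x : PhaseModel (k + 1) N) (hx : x.1.1 = 0) (v : Fin k → PhaseModel (k + 1) N) :
    thetaStd k N p (Fin.cons x v) = hamStd k N (p x.1.2) v := by
  rw [thetaStd_apply, Fin.sum_univ_succ, Finset.sum_eq_zero, add_zero]
  · simp
  · intro j _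
    obtain ⟨i, hi⟩ := Fin.exists_succAbove_eq (Fin.succ_ne_zero j).symm
    rw [hamStd_eq_zero _ i, mul_zero]
    rw [Fin.removeNth, hi, Fin.cons_zero, hx]

/-- The coordinate expression of `d_Γ̄ Θ_Γ` in the frame `dx^μ`, `e^A`, `e^μ_A`. -/
def dThetaStd (k N : ℕ) : PhaseModel (k + 1) N [⋀^Fin (k + 1 + 1)]→L[ℝ] ℝ :=
  ContinuousAlternatingMap.alternatizeUncurryFin (thetaStd k N ∘L
    ContinuousLinearMap.snd ℝ (EuclideanSpace ℝ (Fin (k + 1)) × EuclideanSpace ℝ (Fin N)) _)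

/-- Isolates the term in which `x` itself supplies the direction of differentiation; in the others
`x` stays in front and the sign shifts by one. -/
theorem dThetaStd_cons {k N : ℕ} (x : PhaseModel (k + 1) N)
    (v : Fin (k + 1) → PhaseModel (k + 1) N) :
    dThetaStd k N (Fin.cons x v) = thetaStd k N x.2 v -
      ∑ i : Fin (k + 1), (-1 : ℝ) ^ (i : ℕ) *
        thetaStd k N (v i).2 (Fin.cons x (i.removeNth v)) := by
  refine (ContinuousAlternatingMap.alternatizeUncurryFin_apply _ _).trans ?_
  rw [Fin.sum_univ_succ, sub_eq_add_neg, ← Finset.sum_neg_distrib]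
  congr 1
  · simp
  · refine Finset.sum_congr rfl fun i _ => ?_
    have h : i.succ.removeNth (α := fun _ => PhaseModel (k + 1) N) (Fin.cons x v) =
        Fin.cons x (i.removeNth v) := by
      funext j
      refine Fin.cases ?_ (fun j => ?_) j <;> simp [Fin.removeNth]
    rw [h, Fin.val_succ, pow_succ]
    simp [ContinuousLinearMap.comp_apply]

variable {n N : ℕ} {M E F : Type*}
  [TopologicalSpace M] [ChartedSpace (EuclideanSpace ℝ (Fin n)) M]
  [TopologicalSpace E] [ChartedSpace (EuclideanSpace ℝ (Fin (n + N))) E]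
  [TopologicalSpace F] [ChartedSpace (EuclideanSpace ℝ (Fin N)) F]
  [IsManifold (𝓡 n) ∞ M] [IsManifold (𝓡 N) ∞ F]
  {B : SmoothFibreBundle n N M E F}

/-! ### The frame of a horizontal lift, and horizontal forms. -/

section Lift

variable {hor : (q : B.Phase) → TangentSpace (𝓡 n) (B.toBase q) →L[ℝ] B.PhaseTangent q}
  (c : B.AdaptedChart)

theorem AdaptedChart.horFrame_apply
    (hor : (q : B.Phase) → TangentSpace (𝓡 n) (B.toBase q) →L[ℝ] B.PhaseTangent q)
    {y : PhaseModel n N} (hy : y ∈ c.phaseChart.target) (w : PhaseModel n N) :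
    c.horFrame hor y w = vertPart n N w + c.dPhase (c.phaseChart.symm y)
      (hor (c.phaseChart.symm y)
        ((c.dBaseEquiv (c.phaseChart.map_target hy)).symm w.1.1)) := by
  rw [horFrame, c.inverse_dBase (c.phaseChart.map_target hy)]
  rfl

theorem AdaptedChart.horFrame_base (hlift : ∀ q u, B.tangentToBase q (hor q u) = u)
    {y : PhaseModel n N} (hy : y ∈ c.phaseChart.target) (w : PhaseModel n N) :
    (c.horFrame hor y w).1.1 = w.1.1 := by
  rw [c.horFrame_apply hor hy, Prod.fst_add, Prod.fst_add,
    ← c.dBaseEquiv_tangentToBase (c.phaseChart.map_target hy), hlift,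
    ContinuousLinearEquiv.apply_symm_apply, vertPart_apply, zero_add]

theorem AdaptedChart.horFrame_of_vert {y : PhaseModel n N} (hy : y ∈ c.phaseChart.target)
    (w : PhaseModel n N) (hw : w.1.1 = 0) : c.horFrame hor y w = w := by
  rw [c.horFrame_apply hor hy, hw, map_zero, map_zero, map_zero, add_zero, vertPart_apply]
  exact Prod.ext (Prod.ext hw.symm rfl) rfl

/-- The frame of a connection as an automorphism of the model space. -/
def AdaptedChart.horFrameEquiv (hlift : ∀ q u, B.tangentToBase q (hor q u) = u)
    {y : PhaseModel n N} (hy : y ∈ c.phaseChart.target) : PhaseModel n N ≃L[ℝ] PhaseModel n N :=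
  -- The frame map `T` preserves base components and fixes vertical vectors. So `w - T w` is
  -- vertical and fixed by `T`, that is `(T - 1)² = 0`, and `1 + (1 - T)` inverts `T`.
  have key : ∀ w, c.horFrame hor y (w - c.horFrame hor y w) = w - c.horFrame hor y w := fun w =>
    c.horFrame_of_vert hy _ (by
      rw [Prod.fst_sub, Prod.fst_sub, c.horFrame_base hlift hy, sub_self])
  ContinuousLinearEquiv.equivOfInverse (c.horFrame hor y)
    (ContinuousLinearMap.id ℝ _ + (ContinuousLinearMap.id ℝ _ - c.horFrame hor y))
    (fun w => by
      change c.horFrame hor y w + (c.horFrame hor y w - c.horFrame hor y (c.horFrame hor y w)) = w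
      have h := key w
      rw [map_sub] at h
      rw [h]; abel)
    (fun w => by
      change c.horFrame hor y (w + (w - c.horFrame hor y w)) = w
      rw [map_add, key]; abel)

theorem AdaptedChart.inverse_horFrame (hlift : ∀ q u, B.tangentToBase q (hor q u) = u)
    {y : PhaseModel n N} (hy : y ∈ c.phaseChart.target) :
    (c.horFrame hor y).inverse = (c.horFrameEquiv hlift hy).symm := by
  change ((c.horFrameEquiv hlift hy : PhaseModel n N →L[ℝ] PhaseModel n N)).inverse = _
  rw [ContinuousLinearMap.inverse_equiv]

theorem AdaptedChart.horFrameEquiv_symm_base (hlift : ∀ q u, B.tangentToBase q (hor q u) = u)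
    {y : PhaseModel n N} (hy : y ∈ c.phaseChart.target) (w : PhaseModel n N) :
    ((c.horFrameEquiv hlift hy).symm w).1.1 = w.1.1 := by
  rw [← c.horFrame_base hlift hy ((c.horFrameEquiv hlift hy).symm w)]
  exact congrArg (fun w => w.1.1) ((c.horFrameEquiv hlift hy).apply_symm_apply w)

theorem AdaptedChart.horFrameEquiv_symm_of_vert
    (hlift : ∀ q u, B.tangentToBase q (hor q u) = u)
    {y : PhaseModel n N} (hy : y ∈ c.phaseChart.target) (w : PhaseModel n N) (hw : w.1.1 = 0) :
    (c.horFrameEquiv hlift hy).symm w = w := by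
  rw [ContinuousLinearEquiv.symm_apply_eq]
  exact (c.horFrame_of_vert hy w hw).symm

theorem PhaseForm.inChart_apply {r : ℕ} (α : B.PhaseForm r) {y : PhaseModel n N}
    (hy : y ∈ c.phaseChart.target) (v : Fin r → PhaseModel n N) :
    α.inChart c y v =
      α (c.phaseChart.symm y) fun i => (c.dPhase (c.phaseChart.symm y)).inverse (v i) := by
  rw [← c.mfderiv_phaseChart_symm hy]
  rfl

theorem PhaseForm.IsHorizontal.inChart_eq_zero {r : ℕ} {α : B.PhaseForm r} (hα : α.IsHorizontal)
    {y : PhaseModel n N} (hy : y ∈ c.phaseChart.target) (v : Fin r → PhaseModel n N) (i : Fin r)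
    (hv : (v i).1.1 = 0) : α.inChart c y v = 0 := by
  rw [α.inChart_apply c hy]
  refine hα _ _ i ?_
  rw [c.tangentToBase_inverse_dPhase (c.phaseChart.map_target hy), hv, map_zero]

/-- The arguments are exchanged one at a time; each exchange changes the value by a term with a
vertical argument. -/
theorem PhaseForm.IsHorizontal.inChart_congr {r : ℕ} {α : B.PhaseForm r} (hα : α.IsHorizontal)
    {y : PhaseModel n N} (hy : y ∈ c.phaseChart.target) (v v' : Fin r → PhaseModel n N)
    (hv : ∀ i, (v i).1.1 = (v' i).1.1) : α.inChart c y v = α.inChart c y v' := by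
  classical
  have h : ∀ S : Finset (Fin r), α.inChart c y (S.piecewise v' v) = α.inChart c y v := by
    intro S
    induction S using Finset.induction_on with
    | empty => simp
    | insert i S hi ih =>
      rw [← ih, Finset.piecewise_insert, ← sub_eq_zero]
      have h1 : S.piecewise v' v = Function.update (S.piecewise v' v) i (v i) := by
        rw [eq_comm, Function.update_eq_self_iff]; simp [hi]
      conv_lhs => enter [2]; rw [h1]
      rw [← ContinuousAlternatingMap.map_update_sub]
      exact hα.inChart_eq_zero c hy _ i (by simp [hv])
  simpa using (h Finset.univ).symm

theorem PhaseForm.IsHorizontal.inChart_comp_horFrame {r : ℕ} {α : B.PhaseForm r}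
    (hα : α.IsHorizontal) (hlift : ∀ q u, B.tangentToBase q (hor q u) = u)
    {y : PhaseModel n N} (hy : y ∈ c.phaseChart.target) :
    (α.inChart c y).compContinuousLinearMap (c.horFrame hor y) = α.inChart c y := by
  ext v
  exact hα.inChart_congr c hy _ _ fun i => c.horFrame_base hlift hy (v i)

/-- The derivative of the frame coefficients of a horizontal form does not involve the connection. -/
theorem PhaseForm.IsHorizontal.fderiv_inChart_comp_horFrame {r : ℕ} {α : B.PhaseForm r}
    (hα : α.IsHorizontal) (hlift : ∀ q u, B.tangentToBase q (hor q u) = u)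
    {y : PhaseModel n N} (hy : y ∈ c.phaseChart.target) :
    fderiv ℝ (fun y => (α.inChart c y).compContinuousLinearMap (c.horFrame hor y)) y =
      fderiv ℝ (α.inChart c) y := by
  refine Filter.EventuallyEq.fderiv_eq ?_
  filter_upwards [c.phaseChart.open_target.mem_nhds hy] with y' hy'
  exact hα.inChart_comp_horFrame c hlift hy'

end Lift

/-! ### The two properties of Γ̄ that the argument needs. -/

section Connection

variable [IsManifold (𝓡 (n + N)) ∞ E] (Γ : B.Connection) (c : B.AdaptedChart)
  (Λ : CovariantDerivative (𝓡 n) (EuclideanSpace ℝ (Fin n))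
    (fun m : M => TangentSpace (𝓡 n) m))

theorem Connection.coeff_tot {e : E} (he : e ∈ c.tot.source) (u : EuclideanSpace ℝ (Fin n)) :
    Γ.coeff c (c.tot e) u = -(c.totEquiv he (Γ.vert e ((c.totEquiv he).symm (u, 0)))).2 := by
  -- `coeff` is evaluated at `tot.symm (tot e)`, which equals `e` only propositionally; generalizing
  -- the point allows the tangent spaces to be identified.
  have h : ∀ e', e' = e → (-(ContinuousLinearMap.snd ℝ (EuclideanSpace ℝ (Fin n))
      (EuclideanSpace ℝ (Fin N)) ∘L
    c.dTot e' ∘L Γ.vert e' ∘L (c.dTot e').inverse ∘L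
    ContinuousLinearMap.inl ℝ (EuclideanSpace ℝ (Fin n)) (EuclideanSpace ℝ (Fin N)))) u =
      -(c.totEquiv he (Γ.vert e ((c.totEquiv he).symm (u, 0)))).2 := by
    rintro _ rfl
    rw [c.inverse_dTot he]
    rfl
  exact h _ (c.tot.left_inv he)

theorem Connection.vert_horizontal {e : E} (he : e ∈ c.tot.source)
    (u : EuclideanSpace ℝ (Fin n)) :
    Γ.vert e ((c.totEquiv he).symm (u, Γ.coeff c (c.tot e) u)) = 0 := by
  have h1 : ((u, Γ.coeff c (c.tot e) u) :
      EuclideanSpace ℝ (Fin n) × EuclideanSpace ℝ (Fin N)) =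
      (u, 0) + (0, Γ.coeff c (c.tot e) u) := by simp
  have h2 := Γ.vert_of_mem e _ ((c.vertEquiv he).symm (Γ.coeff c (c.tot e) u)).2
  rw [c.vertEquiv_symm_val] at h2
  rw [h1, map_add, map_add, h2, ← (c.totEquiv he).map_eq_zero_iff, map_add,
    ContinuousLinearEquiv.apply_symm_apply]
  refine Prod.ext ?_ ?_
  · have h3 : B.tangentProj e (Γ.vert e ((c.totEquiv he).symm (u, 0))) = 0 := Γ.vert_mem e _
    rw [Prod.fst_add, c.fst_totEquiv, h3, map_zero]
    simp
  · rw [Prod.snd_add, Γ.coeff_tot c he]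
    simp

/-- `bar` uses a possibly different chart at each point. This property and the next one are
coordinate free, so they let Γ̄ be used in any chart without first comparing charts. -/
theorem Connection.tangentToBase_bar (q : B.Phase) (u : TangentSpace (𝓡 n) (B.toBase q)) :
    B.tangentToBase q (Γ.bar Λ q u) = u := by
  have hq := mem_phaseChart_adaptedChartAt q
  refine ((B.adaptedChartAt (B.toTotal q)).tangentToBase_inverse_dPhase hq _).trans ?_
  exact ((B.adaptedChartAt (B.toTotal q)).dBaseEquiv hq).symm_apply_apply u

theorem Connection.vert_tangentToTotal_bar (q : B.Phase)
    (u : TangentSpace (𝓡 n) (B.toBase q)) :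
    Γ.vert (B.toTotal q) (B.tangentToTotal q (Γ.bar Λ q u)) = 0 := by
  have hq := mem_phaseChart_adaptedChartAt q
  refine (congrArg _
    ((B.adaptedChartAt (B.toTotal q)).tangentToTotal_inverse_dPhase hq _)).trans ?_
  exact Γ.vert_horizontal (B.adaptedChartAt (B.toTotal q)) hq _

end Connection

end SmoothFibreBundle

end

/-! ### Θ_Γ, Ω_Γ and the Hamiltonian equation in the frame. -/

noncomputable section

namespace SmoothFibreBundle

variable {k N : ℕ} {M E F : Type*}
  [TopologicalSpace M] [ChartedSpace (EuclideanSpace ℝ (Fin (k + 1))) M]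
  [TopologicalSpace E] [ChartedSpace (EuclideanSpace ℝ (Fin (k + 1 + N))) E]
  [TopologicalSpace F] [ChartedSpace (EuclideanSpace ℝ (Fin N)) F]
  [IsManifold (𝓡 (k + 1)) ∞ M] [IsManifold (𝓡 N) ∞ F] [IsManifold (𝓡 (k + 1 + N)) ∞ E]
  {B : SmoothFibreBundle (k + 1) N M E F} (Γ : B.Connection)
  (Λ : CovariantDerivative (𝓡 (k + 1)) (EuclideanSpace ℝ (Fin (k + 1)))
    (fun m : M => TangentSpace (𝓡 (k + 1)) m))

/-- The last `k` arguments are already alternating, so the sum over permutations has only `k + 1`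
different terms, each occurring `k!` times; `k! / (k+1)!` leaves the factor `1 / n`. -/
theorem Connection.thetaPure_apply_succAbove (q : B.Phase)
    (α : B.VertAt (B.toTotal q) →L[ℝ] TangentSpace (𝓡 (k + 1)) (B.toBase q))
    (η : TangentSpace (𝓡 (k + 1)) (B.toBase q) [⋀^Fin (k + 1)]→L[ℝ] ℝ)
    (v : Fin (k + 1) → B.PhaseTangent q) :
    Γ.thetaPure q α η v = ∑ i : Fin (k + 1), (-1 : ℝ) ^ (i : ℕ) * (((k + 1 : ℕ) : ℝ)⁻¹ *
      η (Fin.cons (α (Γ.toVert (B.toTotal q) (B.tangentToTotal q (v i))))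
        (fun j : Fin k => B.tangentToBase q (v (i.succAbove j))))) := by
  have h := sum_perm_fin_succ_of_alternating (fun (i : Fin (k + 1)) (f : Fin k → Fin (k + 1)) =>
      η (Fin.cons (α (Γ.toVert (B.toTotal q) (B.tangentToTotal q (v i))))
        (fun j : Fin k => B.tangentToBase q (v (f j))))) (fun i f τ => by
    have h1 := (η.toAlternatingMap.curryLeft
      (α (Γ.toVert (B.toTotal q) (B.tangentToTotal q (v i))))).map_perm
        (fun j : Fin k => B.tangentToBase q (v (f j))) τ
    refine Eq.trans h1 ?_
    rw [Units.smul_def, zsmul_eq_mul]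
    rfl)
  have hk : ((k + 1).factorial : ℝ)⁻¹ * (k.factorial : ℝ) = ((k + 1 : ℕ) : ℝ)⁻¹ := by
    rw [Nat.factorial_succ]
    have : (k.factorial : ℝ) ≠ 0 := by positivity
    have : ((k + 1 : ℕ) : ℝ) ≠ 0 := by positivity
    push_cast at *
    field_simp
  rw [Γ.thetaPure_apply]
  simp only [div_eq_inv_mul, mul_assoc]
  rw [← Finset.mul_sum]
  refine (congrArg (fun x => ((k + 1).factorial : ℝ)⁻¹ * x) h).trans ?_
  rw [← mul_assoc, hk, Finset.mul_sum]
  exact Finset.sum_congr rfl fun i _ => mul_left_comm _ _ _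

theorem Connection.theta_apply (c : B.AdaptedChart) {q : B.Phase}
    (hq : B.toTotal q ∈ c.tot.source) (v : Fin (k + 1) → B.PhaseTangent q) :
    Γ.theta q v = ∑ i : Fin (k + 1), (-1 : ℝ) ^ (i : ℕ) *
      hamStd k N ((c.phaseChart q).2 (c.totEquiv hq
          (Γ.vert (B.toTotal q) (B.tangentToTotal q (v i)))).2)
        (fun j => c.dPhase q (v (i.succAbove j))) := by
  -- Since `Λⁿ T_m^* M` is a line, the chosen coordinates exhibit every element of the fibre as one
  -- pure tensor with second factor `dⁿx`; no sum of tensors has to be handled.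
  have h1 : q.2 = (c.fibreEquiv hq).symm (c.phaseChart q).2 := by
    rw [c.snd_phaseChart hq]
    exact ((c.fibreEquiv hq).symm_apply_apply _).symm
  have h2 : Γ.theta q = Γ.thetaPure q _ _ := (congrArg (TensorProduct.lift _)
    (h1.trans (c.fibreEquiv_symm_apply hq _))).trans (TensorProduct.lift.tmul _ _)
  refine (congrArg (fun f => f v) h2).trans ((Γ.thetaPure_apply_succAbove q _ _ v).trans ?_)
  refine Finset.sum_congr rfl fun i _ => ?_
  rw [hamStd_apply]
  congr 2
  change stdVol (k + 1) _ = stdVol (k + 1) _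
  congr 1
  funext j
  refine Fin.cases ?_ (fun j => ?_) j
  · exact (c.baseEquiv hq).apply_symm_apply _
  · exact c.dBaseEquiv_tangentToBase hq _

/-- P_Γ kills the lifted part of a frame vector and fixes its vertical part, so the distinguished
argument contributes `e^A`; the others contribute only `dx^μ`. The coefficients therefore depend
only on `p`, and linearly. -/
theorem Connection.theta_inChart_comp_horFrame (c : B.AdaptedChart) {y : PhaseModel (k + 1) N}
    (hy : y ∈ c.phaseChart.target) :
    (Γ.theta.inChart c y).compContinuousLinearMap (c.horFrame (Γ.bar Λ) y) =
      thetaStd k N y.2 := by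
  have hq := c.phaseChart.map_target hy
  have hq' : B.toTotal (c.phaseChart.symm y) ∈ c.tot.source := hq
  have hyq := c.phaseChart.right_inv hy
  ext v
  refine (Γ.theta.inChart_apply c hy _).trans ?_
  rw [Γ.theta_apply c hq', thetaStd_apply, hyq]
  refine Finset.sum_congr rfl fun i _ => ?_
  have h1 : (c.totEquiv hq' (Γ.vert (B.toTotal (c.phaseChart.symm y))
      (B.tangentToTotal (c.phaseChart.symm y) ((c.dPhase (c.phaseChart.symm y)).inverse
        (c.horFrame (Γ.bar Λ) y (v i)))))).2 = (v i).1.2 := by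
    rw [c.horFrame_apply _ hy, map_add, map_add, map_add, c.inverse_dPhase_apply hq,
      Γ.vert_tangentToTotal_bar, add_zero, c.tangentToTotal_inverse_dPhase hq', vertPart_apply]
    have h2 : Γ.vert (B.toTotal (c.phaseChart.symm y)) ((c.totEquiv hq').symm (0, (v i).1.2)) =
        (c.totEquiv hq').symm (0, (v i).1.2) :=
      Γ.vert_of_mem (B.toTotal (c.phaseChart.symm y)) _
        ((c.vertEquiv hq').symm (v i).1.2).2
    dsimp only
    rw [h2, ContinuousLinearEquiv.apply_symm_apply]
  congr 1
  refine Eq.trans (congrArg (fun a => hamStd k N (y.2 a) _) h1) ?_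
  rw [hamStd_apply, hamStd_apply]
  congr 2
  congr 1
  funext j
  change (c.dPhase _ ((c.dPhase _).inverse (c.horFrame (Γ.bar Λ) y (v (i.succAbove j))))).1.1 = _
  rw [c.dPhase_inverse_apply hq, c.horFrame_base (Γ.tangentToBase_bar Λ) hy]
  rfl

/-- `hc` says that `c` is the chart in which `vertDiff` is defined at this point. That chart depends
only on the point of `E`, so one chart serves a whole fibre of `P → E`. -/
theorem Connection.omega_apply {y : PhaseModel (k + 1) N} (c : B.AdaptedChart)
    (hc : c = B.adaptedChartAt (B.toTotal (c.phaseChart.symm y)))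
    (hy : y ∈ c.phaseChart.target) (v : Fin (k + 1 + 1) → B.PhaseTangent (c.phaseChart.symm y)) :
    Γ.omega Λ (c.phaseChart.symm y) v =
      -dThetaStd k N fun i => (c.horFrameEquiv (Γ.tangentToBase_bar Λ) hy).symm
        (c.dPhase (c.phaseChart.symm y) (v i)) := by
  have hq := c.phaseChart.map_target hy
  have hyq := c.phaseChart.right_inv hy
  have h1 : Γ.omega Λ (c.phaseChart.symm y) v =
      -(Γ.theta.vertDiffIn (Γ.bar Λ) c (c.phaseChart.symm y) v) := by
    have h : ∀ (q : B.Phase) v, Γ.omega Λ q v =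
      -(Γ.theta.vertDiffIn (Γ.bar Λ) (B.adaptedChartAt (B.toTotal q)) q v) := fun _ _ => rfl
    rw [h, ← hc]
  have h2 : fderiv ℝ (fun y => (Γ.theta.inChart c y).compContinuousLinearMap
      (c.horFrame (Γ.bar Λ) y)) y = thetaStd k N ∘L ContinuousLinearMap.snd ℝ _ _ := by
    have h3 : (fun y => (Γ.theta.inChart c y).compContinuousLinearMap
        (c.horFrame (Γ.bar Λ) y)) =ᶠ[nhds y] (thetaStd k N ∘L ContinuousLinearMap.snd ℝ _ _) := by
      filter_upwards [c.phaseChart.open_target.mem_nhds hy] with y' hy'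
      exact Γ.theta_inChart_comp_horFrame Λ c hy'
    rw [h3.fderiv_eq, ContinuousLinearMap.fderiv]
  -- The frame coefficients of Θ_Γ vary only with the momenta, which `vertPart` leaves alone.
  have h4 : (thetaStd k N ∘L ContinuousLinearMap.snd ℝ _ _) ∘L vertPart (k + 1) N =
      thetaStd k N ∘L ContinuousLinearMap.snd ℝ _ _ := rfl
  rw [h1, PhaseForm.vertDiffIn, hyq, h2, h4, c.inverse_horFrame (Γ.tangentToBase_bar Λ) hy]
  rfl

theorem PhaseForm.IsHorizontal.vertDiff_apply {r : ℕ} {H : B.PhaseForm r} (hH : H.IsHorizontal)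
    {y : PhaseModel (k + 1) N} (c : B.AdaptedChart)
    (hc : c = B.adaptedChartAt (B.toTotal (c.phaseChart.symm y)))
    (hy : y ∈ c.phaseChart.target) (v : Fin (r + 1) → B.PhaseTangent (c.phaseChart.symm y)) :
    H.vertDiff (Γ.bar Λ) (c.phaseChart.symm y) v =
      ContinuousAlternatingMap.alternatizeUncurryFin
        (fderiv ℝ (H.inChart c) y ∘L vertPart (k + 1) N)
        fun i => (c.horFrameEquiv (Γ.tangentToBase_bar Λ) hy).symm
          (c.dPhase (c.phaseChart.symm y) (v i)) := by
  have hyq := c.phaseChart.right_inv hy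
  have h1 : H.vertDiff (Γ.bar Λ) (c.phaseChart.symm y) v =
      H.vertDiffIn (Γ.bar Λ) c (c.phaseChart.symm y) v := by
    have h : ∀ (q : B.Phase) v, H.vertDiff (Γ.bar Λ) q v =
      H.vertDiffIn (Γ.bar Λ) (B.adaptedChartAt (B.toTotal q)) q v := fun _ _ => rfl
    rw [h, ← hc]
  rw [h1, PhaseForm.vertDiffIn, hyq, hH.fderiv_inChart_comp_horFrame c (Γ.tangentToBase_bar Λ) hy,
    c.inverse_horFrame (Γ.tangentToBase_bar Λ) hy]
  rfl

/-- The equation `d_Γ̄ H = X ⌟ Ω_Γ` in the coordinates that define `d_Γ̄`. -/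
theorem PhaseForm.IsHorizontal.vertDiff_eq_contract_iff {H : B.PhaseForm k}
    (hH : H.IsHorizontal) (X : B.PhaseField) {y : PhaseModel (k + 1) N} (c : B.AdaptedChart)
    (hc : c = B.adaptedChartAt (B.toTotal (c.phaseChart.symm y)))
    (hy : y ∈ c.phaseChart.target) :
    H.vertDiff (Γ.bar Λ) (c.phaseChart.symm y) = (Γ.omega Λ).contract X (c.phaseChart.symm y) ↔
      ∀ v, ContinuousAlternatingMap.alternatizeUncurryFin
        (fderiv ℝ (H.inChart c) y ∘L vertPart (k + 1) N) v =
        -dThetaStd k N (Fin.cons ((c.horFrameEquiv (Γ.tangentToBase_bar Λ) hy).symm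
          (c.dPhase (c.phaseChart.symm y) (X (c.phaseChart.symm y)))) v) := by
  have hq := c.phaseChart.map_target hy
  have h1 : ∀ v, (Γ.omega Λ).contract X (c.phaseChart.symm y) v =
      -dThetaStd k N (Fin.cons ((c.horFrameEquiv (Γ.tangentToBase_bar Λ) hy).symm
          (c.dPhase (c.phaseChart.symm y) (X (c.phaseChart.symm y))))
        fun i => (c.horFrameEquiv (Γ.tangentToBase_bar Λ) hy).symm
          (c.dPhase (c.phaseChart.symm y) (v i))) := by
    intro v
    refine (Γ.omega_apply Λ c hc hy (Fin.cons (X (c.phaseChart.symm y)) v)).trans ?_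
    congr 2
    funext i
    refine Fin.cases rfl (fun i => rfl) i
  constructor
  · intro h v
    have h2 := congrArg (fun f => f fun i => (c.dPhaseEquiv hq).symm
      (c.horFrameEquiv (Γ.tangentToBase_bar Λ) hy (v i))) h
    have h3 : (fun i => (c.horFrameEquiv (Γ.tangentToBase_bar Λ) hy).symm
          (c.dPhase (c.phaseChart.symm y) ((c.dPhaseEquiv hq).symm
      (c.horFrameEquiv (Γ.tangentToBase_bar Λ) hy (v i))))) = v := by
      funext i
      rw [← c.dPhaseEquiv_apply hq, ContinuousLinearEquiv.apply_symm_apply,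
        ContinuousLinearEquiv.symm_apply_apply]
    have h4 := (hH.vertDiff_apply Γ Λ c hc hy _).symm.trans (h2.trans (h1 _))
    rwa [h3] at h4
  · intro h
    refine ContinuousAlternatingMap.ext fun v => ?_
    rw [hH.vertDiff_apply Γ Λ c hc hy, h1, h]

end SmoothFibreBundle

end

/-! ### Projectability of Hamiltonian vector fields. -/

noncomputable section

namespace SmoothFibreBundle

variable {k N : ℕ} {M E F : Type*}
  [TopologicalSpace M] [ChartedSpace (EuclideanSpace ℝ (Fin (k + 1))) M]
  [TopologicalSpace E] [ChartedSpace (EuclideanSpace ℝ (Fin (k + 1 + N))) E]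
  [TopologicalSpace F] [ChartedSpace (EuclideanSpace ℝ (Fin N)) F]
  [IsManifold (𝓡 (k + 1)) ∞ M] [IsManifold (𝓡 N) ∞ F] [IsManifold (𝓡 (k + 1 + N)) ∞ E]
  {B : SmoothFibreBundle (k + 1) N M E F} (Γ : B.Connection)
  (Λ : CovariantDerivative (𝓡 (k + 1)) (EuclideanSpace ℝ (Fin (k + 1)))
    (fun m : M => TangentSpace (𝓡 (k + 1)) m))

theorem PhaseForm.IsSmooth.differentiableAt {r : ℕ} {H : B.PhaseForm r} (hs : H.IsSmooth)
    (c : B.AdaptedChart) {y : PhaseModel (k + 1) N} (hy : y ∈ c.phaseChart.target) :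
    DifferentiableAt ℝ (H.inChart c) y :=
  ((hs c).contDiffAt (c.phaseChart.open_target.mem_nhds hy)).differentiableAt (by simp)

theorem hasFDerivAt_alternating_apply {V W : Type*} [NormedAddCommGroup V] [NormedSpace ℝ V]
    [NormedAddCommGroup W] [NormedSpace ℝ W] {r : ℕ} {f : V → W [⋀^Fin r]→L[ℝ] ℝ}
    {f' : V →L[ℝ] W [⋀^Fin r]→L[ℝ] ℝ} {y : V}
    (h : HasFDerivAt f f' y) (v : Fin r → W) :
    HasFDerivAt (fun y => f y v) (ContinuousAlternatingMap.apply ℝ W ℝ v ∘L f') y :=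
  (ContinuousAlternatingMap.apply ℝ W ℝ v).hasFDerivAt.comp y h

/-- The coefficient with a fixed vertical argument vanishes near `y`, not only at `y`, so its
derivative vanishes too. -/
theorem PhaseForm.IsHorizontal.fderiv_inChart_eq_zero {r : ℕ} {H : B.PhaseForm r}
    (hH : H.IsHorizontal) (hs : H.IsSmooth) (c : B.AdaptedChart) {y : PhaseModel (k + 1) N}
    (hy : y ∈ c.phaseChart.target) (w : PhaseModel (k + 1) N)
    (v : Fin r → PhaseModel (k + 1) N) (i : Fin r) (hv : (v i).1.1 = 0) :
    fderiv ℝ (H.inChart c) y w v = 0 := by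
  have h1 := hasFDerivAt_alternating_apply (hs.differentiableAt c hy).hasFDerivAt v
  have h2 : (fun y => H.inChart c y v) =ᶠ[nhds y] fun _ => 0 := by
    filter_upwards [c.phaseChart.open_target.mem_nhds hy] with y' hy'
    exact hH.inChart_eq_zero c hy' v i hv
  have h3 := h1.fderiv.symm.trans (h2.fderiv_eq.trans (fderiv_const_apply _))
  exact congrArg (fun f => f w) h3

/-- The derivative of a Hamiltonian form in the direction of the momenta `p^μ_A`. -/
theorem fderiv_inChart_momentum {H : B.PhaseForm k}
    (hH : H.IsHorizontal) (hs : H.IsSmooth) (c : B.AdaptedChart) {y : PhaseModel (k + 1) N}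
    (hy : y ∈ c.phaseChart.target) {ξ : PhaseModel (k + 1) N}
    (h : ∀ v, ContinuousAlternatingMap.alternatizeUncurryFin
        (fderiv ℝ (H.inChart c) y ∘L vertPart (k + 1) N) v = -dThetaStd k N (Fin.cons ξ v))
    (s : EuclideanSpace ℝ (Fin N) →L[ℝ] EuclideanSpace ℝ (Fin (k + 1)))
    (v : Fin k → PhaseModel (k + 1) N) (hv : ∀ j, (v j).2 = 0) :
    fderiv ℝ (H.inChart c) y ((0, 0), s) v = thetaStd k N s (Fin.cons ξ v) := by
  -- The momentum vector is vertical, so on the left only the term differentiating along it remains.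
  -- On the right, Θ at momentum `ξ.2` sees no `v^A` component in it, and the `v j` have no momentum
  -- part.
  have h1 := h (Fin.cons ((0, 0), s) v)
  rw [ContinuousAlternatingMap.alternatizeUncurryFin_apply, Fin.sum_univ_succ,
    Finset.sum_eq_zero, dThetaStd_cons, Fin.sum_univ_succ, Finset.sum_eq_zero,
    thetaStd_cons _ _ rfl] at h1
  · simpa [vertPart_apply] using h1
  · intro i _
    rw [Fin.cons_succ, hv, map_zero]
    simp
  · intro i _
    obtain ⟨j, hj⟩ := Fin.exists_succAbove_eq (Fin.succ_ne_zero i).symm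
    rw [ContinuousLinearMap.comp_apply, hH.fderiv_inChart_eq_zero hs c hy _ _ j, smul_zero]
    rw [Fin.removeNth, hj, Fin.cons_zero]

/-- The `∂_μ` components of a Hamiltonian vector field vanish if the fibres of `E` have positive
dimension. -/
theorem base_eq_zero_of_momentum (hk : 1 ≤ k) (a₀ : Fin N) {H : B.PhaseForm k}
    (hH : H.IsHorizontal) (hs : H.IsSmooth) (c : B.AdaptedChart) {y : PhaseModel (k + 1) N}
    (hy : y ∈ c.phaseChart.target) {ξ : PhaseModel (k + 1) N}
    (h : ∀ v, ContinuousAlternatingMap.alternatizeUncurryFin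
        (fderiv ℝ (H.inChart c) y ∘L vertPart (k + 1) N) v = -dThetaStd k N (Fin.cons ξ v)) :
    ξ.1.1 = 0 := by
  obtain ⟨m, rfl⟩ : ∃ m, k = m + 1 := ⟨k - 1, by omega⟩
  refine eq_zero_of_stdVol_eq_zero 1 _ fun v hv => ?_
  let s : EuclideanSpace ℝ (Fin N) →L[ℝ] EuclideanSpace ℝ (Fin (m + 1 + 1)) :=
    (EuclideanSpace.proj a₀ : EuclideanSpace ℝ (Fin N) →L[ℝ] ℝ).smulRight (v 0)
  -- With `x` as an argument the horizontal form has zero derivative. As `s` sends the fibre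
  -- direction `a₀` to `v 0`, moving `x` to the front turns the right side into a multiple of `dⁿx
  -- (v 0, ξ^μ, v 2, …)`.
  let x : PhaseModel (m + 1 + 1) N := ((0, EuclideanSpace.single a₀ 1), 0)
  let v' : Fin m → PhaseModel (m + 1 + 1) N := fun j => ((v j.succ.succ, 0), 0)
  have h1 := fderiv_inChart_momentum hH hs c hy h s (Fin.cons x v')
    (fun j => Fin.cases rfl (fun _ => rfl) j)
  rw [hH.fderiv_inChart_eq_zero hs c hy _ _ 0 rfl] at h1
  have h2 := (thetaStd (m + 1) N s).toAlternatingMap.map_swap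
    (Fin.cons ξ (Fin.cons x v')) (i := 0) (j := 1) (by simp)
  have h3 : (Fin.cons ξ (Fin.cons x v') : Fin (m + 1 + 1) → PhaseModel (m + 1 + 1) N) ∘
      Equiv.swap 0 1 = Fin.cons x (Fin.cons ξ v') := by
    funext i
    refine Fin.cases ?_ (fun i => Fin.cases ?_ (fun i => ?_) i) i
    · simp
    · change (Fin.cons ξ (Fin.cons x v') : Fin (m + 1 + 1) → PhaseModel (m + 1 + 1) N)
        (Equiv.swap 0 1 1) = _
      rw [Equiv.swap_apply_right]; rfl
    · rw [Function.comp_apply, Equiv.swap_apply_of_ne_of_ne (Fin.succ_ne_zero _)]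
      · rfl
      · intro h
        exact Fin.succ_ne_zero i (Fin.succ_injective _ h)
  rw [h3] at h2
  have h4 := h2.trans (neg_eq_zero.2 h1.symm)
  have h5 := (thetaStd_cons s x rfl (Fin.cons ξ v')).symm.trans h4
  rw [hamStd_apply] at h5
  have h6 := (mul_eq_zero.1 h5).resolve_left (by positivity)
  refine Eq.trans ?_ h6
  congr 1
  funext i
  refine Fin.cases ?_ (fun i => Fin.cases ?_ (fun i => ?_) i) i
  · simp [s, x]
  · exact hv
  · rfl

/-- Once the base components vanish, the frame and chart components of X agree, and the momentum
derivatives of the coefficients of H have the form required by `eq_of_hasFDerivAt_apply`. -/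
theorem component_eq_of_hamiltonian (hk : 1 ≤ k) {X : B.PhaseField} {H : B.PhaseForm k}
    (hX : Γ.IsHamiltonianFor Λ H X) (c : B.AdaptedChart)
    {z : EuclideanSpace ℝ (Fin (k + 1)) × EuclideanSpace ℝ (Fin N)} (hz : z ∈ c.tot.target)
    (hc : c = B.adaptedChartAt (c.tot.symm z))
    (p p' : EuclideanSpace ℝ (Fin N) →L[ℝ] EuclideanSpace ℝ (Fin (k + 1))) :
    (c.dPhase (c.phaseChart.symm (z, p)) (X (c.phaseChart.symm (z, p)))).1 =
      (c.dPhase (c.phaseChart.symm (z, p')) (X (c.phaseChart.symm (z, p')))).1 := by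
  -- For `N = 0` there is no fibre direction to insert, but then the space of momenta is trivial as
  -- well.
  rcases Nat.eq_zero_or_pos N with rfl | hN
  · have : p = p' := by
      ext a i
      rw [Subsingleton.elim a 0, map_zero, map_zero]
    rw [this]
  obtain ⟨-, hs, hH, heq⟩ := hX
  have hy : ∀ p, ((z, p) : PhaseModel (k + 1) N) ∈ c.phaseChart.target := fun _ => hz
  have hid := fun p => 
    (hH.vertDiff_eq_contract_iff Γ Λ X (y := (z, p)) c hc (hy p)).1 (congrFun heq _)
  have hbase := fun p => base_eq_zero_of_momentum hk ⟨0, hN⟩ hH hs c (hy p) (hid p)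
  have hbase' : ∀ p, (c.dPhase (c.phaseChart.symm (z, p))
      (X (c.phaseChart.symm (z, p)))).1.1 = 0 := fun p => by
    rw [← hbase p, c.horFrameEquiv_symm_base]
  have hξ := fun p => c.horFrameEquiv_symm_of_vert (Γ.tangentToBase_bar Λ) (hy p) _ (hbase' p)
  refine Prod.ext ((hbase' p).trans (hbase' p').symm) ?_
  -- All coordinate vectors of the base except the `i`-th: evaluation on them gives `H^i` up to
  -- sign, whence the factor `(-1)^i / n` below.
  let e : Fin (k + 1) → Fin k → PhaseModel (k + 1) N := fun i j =>
    ((EuclideanSpace.single (i.succAbove j) 1, 0), 0)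
  have hd : ∀ i p, HasFDerivAt (fun p => H.inChart c (z, p) (e i))
      ((ContinuousAlternatingMap.apply ℝ (PhaseModel (k + 1) N) ℝ (e i) ∘L
        fderiv ℝ (H.inChart c) (z, p)) ∘L ContinuousLinearMap.inr ℝ _ _) p := fun i p =>
    (hasFDerivAt_alternating_apply (hs.differentiableAt c (hy p)).hasFDerivAt (e i)).comp p
      (hasFDerivAt_prodMk_right z p)
  refine eq_of_hasFDerivAt_apply hk
    (fun p => (c.dPhase (c.phaseChart.symm (z, p)) (X (c.phaseChart.symm (z, p)))).1.2)
    (fun i p => H.inChart c (z, p) (e i)) (fun i p => (hd i p).differentiableAt)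
    (fun i => ((k + 1 : ℕ) : ℝ)⁻¹ * (-1) ^ (i : ℕ)) (fun i => by positivity) ?_ p p'
  intro i p s
  rw [(hd i p).fderiv]
  refine (fderiv_inChart_momentum hH hs c (hy p) (hid p) s (e i) (fun j => rfl)).trans ?_
  rw [thetaStd_cons _ _ (hbase p), hξ, hamStd_apply, mul_assoc, ← stdVol_cons_single]

theorem tangentToTotal_eq_of_hamiltonian (hk : 1 ≤ k) {X : B.PhaseField} {H : B.PhaseForm k}
    (hX : Γ.IsHamiltonianFor Λ H X) (e : E) (p p' : B.PhaseFibre e) :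
    (B.tangentToTotal ⟨e, p⟩ (X ⟨e, p⟩) : TangentSpace (𝓡 (k + 1 + N)) e) =
      B.tangentToTotal ⟨e, p'⟩ (X ⟨e, p'⟩) := by
  obtain ⟨c, hc⟩ : ∃ c, c = B.adaptedChartAt e := ⟨_, rfl⟩
  have he : e ∈ c.tot.source := hc ▸ B.mem_adaptedChartAt e
  have hq : ∀ p : B.PhaseFibre e, c.phaseChart.symm (c.tot e, c.fibreEquiv he p) =
      (⟨e, p⟩ : B.Phase) := fun p => by
    have h1 : c.phaseChart (⟨e, p⟩ : B.Phase) = (c.tot e, c.fibreEquiv he p) :=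
      Prod.ext rfl (c.snd_phaseChart (q := (⟨e, p⟩ : B.Phase)) he)
    rw [← h1]
    exact c.phaseChart.left_inv (show (⟨e, p⟩ : B.Phase) ∈ c.phaseChart.source from he)
  have h := component_eq_of_hamiltonian Γ Λ hk hX c (c.tot.map_source he)
    (by rw [c.tot.left_inv he]; exact hc) (c.fibreEquiv he p) (c.fibreEquiv he p')
  rw [hq, hq] at h
  refine (c.totEquiv he).injective ?_
  refine Eq.trans (c.totEquiv_tangentToTotal (q := (⟨e, p⟩ : B.Phase)) he _) (h.trans ?_)
  exact (c.totEquiv_tangentToTotal (q := (⟨e, p'⟩ : B.Phase)) he _).symm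

/-- If `dim M ≥ 2`, Hamiltonian vector fields are projectable onto `E`. -/
theorem isProjectable_of_isHamiltonian (hk : 1 ≤ k) {X : B.PhaseField}
    (hX : Γ.IsHamiltonian Λ X) : B.IsProjectable X := by
  obtain ⟨H, hX⟩ := hX
  have hproj := tangentToTotal_eq_of_hamiltonian Γ Λ hk hX
  -- Any momentum would do; zero is a global choice. Smoothness is checked along a local section of
  -- constant momentum coordinates.
  refine ⟨fun e => B.tangentToTotal (⟨e, 0⟩ : B.Phase) (X ⟨e, 0⟩), fun e₀ => ?_, fun q => ?_⟩
  · obtain ⟨c, hc⟩ : ∃ c : B.AdaptedChart, e₀ ∈ c.tot.source := B.exists_adaptedChart e₀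
    have h1 : ContMDiffOn (𝓡 (k + 1 + N)) 𝓘(ℝ, PhaseModel (k + 1) N) ∞
        (fun e => c.phaseChart.symm (c.tot e, 0)) c.tot.source :=
      c.contMDiffOn_phaseChart_symm.comp (c.tot_smooth.prodMk_space contMDiffOn_const)
        fun e he => c.tot.map_source he
    have h2 := (contMDiff_toTotal (B := B)).contMDiff_tangentMap (m := ∞) (by simp)
    have h3 := (h2.comp hX.1).comp_contMDiffOn h1
    refine (h3.congr fun e he => ?_).contMDiffAt (c.tot.open_source.mem_nhds hc)
    have hfst : B.toTotal (c.phaseChart.symm (c.tot e, 0)) = e := c.tot.left_inv he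
    have key : ∀ q : B.Phase, B.toTotal q = e →
        (⟨e, B.tangentToTotal (⟨e, 0⟩ : B.Phase) (X ⟨e, 0⟩)⟩ : TangentBundle (𝓡 (k + 1 + N)) E) =
          ⟨B.toTotal q, B.tangentToTotal q (X q)⟩ := by
      rintro ⟨e', p⟩ rfl
      exact congrArg (Bundle.TotalSpace.mk _) (hproj e' 0 p)
    exact key _ hfst
  · obtain ⟨e, p⟩ := q
    exact hproj e p 0

end SmoothFibreBundle

end

/-! ### Calculus behind the transformation law of the canonical lift. -/

noncomputable section

/-- The derivative of `ξ' ∘ φ` in a vertical direction, where `ξ'` is the transform of the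
vertical field `ξ` under the coordinate change `φ`. -/
theorem fderiv_verticalTransform {U V : Type*} [NormedAddCommGroup U] [NormedSpace ℝ U]
    [NormedAddCommGroup V] [NormedSpace ℝ V] {φ : U × V → U × V} {z : U × V}
    (hφ : ContDiffAt ℝ ∞ φ z) {ξ ξ' : U × V → V} (hξ : DifferentiableAt ℝ ξ z)
    (hξ' : DifferentiableAt ℝ ξ' (φ z))
    (hrel : ∀ᶠ z' in nhds z, ξ' (φ z') = (fderiv ℝ φ z' (0, ξ z')).2)
    (hvert : ∀ a, (fderiv ℝ φ z (0, a)).1 = 0) (a : V) :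
    (fderiv ℝ ξ' (φ z)) (0, (fderiv ℝ φ z (0, a)).2) =
      (fderiv ℝ (fderiv ℝ φ) z (0, ξ z) (0, a)).2 +
        (fderiv ℝ φ z (0, fderiv ℝ ξ z (0, a))).2 := by
  have hD : HasFDerivAt (fderiv ℝ φ) (fderiv ℝ (fderiv ℝ φ) z) z :=
    ((hφ.fderiv_right (m := ∞) (by simp)).differentiableAt (by simp)).hasFDerivAt
  -- The chain rule delivers the second derivative with `a` as its first argument, whereas
  -- `fderiv_momentum_along_curve` has `ξ z` there; symmetry reconciles the two.
  have hsymm := (hφ.isSymmSndFDerivAt (by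
    rw [minSmoothness_of_isRCLikeNormedField]; exact WithTop.coe_le_coe.2 le_top)).eq (0, ξ z) (0, a)
  have hφ1 : HasFDerivAt φ (fderiv ℝ φ z) z := (hφ.differentiableAt (by simp)).hasFDerivAt
  have h2 := hξ'.hasFDerivAt.comp z hφ1
  have h3 := (hD.clm_apply ((hasFDerivAt_const (0 : U) z).prodMk hξ.hasFDerivAt)).snd
  have h4 := congrArg (fun f => f (0, a)) (h2.unique (h3.congr_of_eventuallyEq hrel))
  have h5 : fderiv ℝ φ z (0, a) = (0, (fderiv ℝ φ z (0, a)).2) := Prod.ext (hvert a) rfl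
  rw [← h5, hsymm, add_comm]
  exact h4

/-- The product rule for the momentum law in the form `p' ∘ V = G ∘ p`, where `V` is the vertical
block of `Dφ`. This form avoids differentiating `V⁻¹`, and `G` is constant as the curve will stay
over one point of the base. -/
theorem fderiv_momentum_along_curve {U V : Type*} [NormedAddCommGroup U] [NormedSpace ℝ U]
    [NormedAddCommGroup V] [NormedSpace ℝ V] {φ : U × V → U × V}
    {γ : ℝ → (U × V) × (V →L[ℝ] U)} {δ : (U × V) × (V →L[ℝ] U)} (hγ : HasDerivAt γ δ 0)
    {φ' : U × V →L[ℝ] U × V →L[ℝ] U × V} (hφ : HasFDerivAt (fderiv ℝ φ) φ' (γ 0).1)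
    {S : (U × V) × (V →L[ℝ] U) → V →L[ℝ] U} (hS : DifferentiableAt ℝ S (γ 0)) (G : U →L[ℝ] U)
    (a : V) (hrel : ∀ᶠ t in nhds 0, S (γ t) (fderiv ℝ φ (γ t).1 (0, a)).2 = G ((γ t).2 a)) :
    fderiv ℝ S (γ 0) δ (fderiv ℝ φ (γ 0).1 (0, a)).2 + S (γ 0) (φ' δ.1 (0, a)).2 =
      G (δ.2 a) := by
  have h1 : HasDerivAt (fun t => S (γ t)) (fderiv ℝ S (γ 0) δ) 0 :=
    hS.hasFDerivAt.comp_hasDerivAt 0 hγ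
  have h2 : HasDerivAt (fun t => fderiv ℝ φ (γ t).1) (φ' δ.1) 0 :=
    hφ.comp_hasDerivAt 0
      ((ContinuousLinearMap.fst ℝ (U × V) (V →L[ℝ] U)).hasFDerivAt.comp_hasDerivAt 0 hγ)
  have h3 : HasDerivAt (fun t => (fderiv ℝ φ (γ t).1 (0, a)).2) (φ' δ.1 (0, a)).2 0 := by
    have h := h2.clm_apply (hasDerivAt_const (0 : ℝ) ((0, a) : U × V))
    rw [map_zero, add_zero] at h
    exact (ContinuousLinearMap.snd ℝ U V).hasFDerivAt.comp_hasDerivAt 0 h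
  have h4 : HasDerivAt (fun t => G ((γ t).2 a)) (G (δ.2 a)) 0 := by
    have h := HasDerivAt.clm_apply
      ((ContinuousLinearMap.snd ℝ (U × V) (V →L[ℝ] U)).hasFDerivAt.comp_hasDerivAt 0 hγ)
      (hasDerivAt_const (0 : ℝ) a)
    rw [map_zero, add_zero] at h
    exact G.hasFDerivAt.comp_hasDerivAt 0 h
  exact (h1.clm_apply h3).unique (h4.congr_of_eventuallyEq hrel)

/-- The transformation law of the momentum components of a canonical lift under a change of
coordinates `φ` of the total space. -/
theorem fderiv_canonicalLift_momentum {U V : Type*} [NormedAddCommGroup U] [NormedSpace ℝ U]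
    [NormedAddCommGroup V] [NormedSpace ℝ V] {φ : U × V → U × V} {z : U × V}
    (hφ : ContDiffAt ℝ ∞ φ z) {ξ ξ' : U × V → V} (hξ : DifferentiableAt ℝ ξ z)
    (hξ' : DifferentiableAt ℝ ξ' (φ z))
    (hrel : ∀ᶠ z' in nhds z, ξ' (φ z') = (fderiv ℝ φ z' (0, ξ z')).2)
    (hvert : ∀ a, (fderiv ℝ φ z (0, a)).1 = 0)
    {p : V →L[ℝ] U} {S : (U × V) × (V →L[ℝ] U) → V →L[ℝ] U}
    (hS : DifferentiableAt ℝ S (z, p)) (G : U →L[ℝ] U)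
    (hSrel : ∀ᶠ y in nhds (z, p), y.1.1 = z.1 → ∀ a,
      S y (fderiv ℝ φ y.1 (0, a)).2 = G (y.2 a)) (a : V) :
    fderiv ℝ S (z, p) ((0, ξ z), -(p ∘L fderiv ℝ ξ z ∘L ContinuousLinearMap.inr ℝ U V))
      (fderiv ℝ φ z (0, a)).2 =
      -S (z, p) (fderiv ℝ ξ' (φ z) (0, (fderiv ℝ φ z (0, a)).2)) := by
  have h1 := fderiv_verticalTransform hφ hξ hξ' hrel hvert a
  have hD : HasFDerivAt (fderiv ℝ φ) (fderiv ℝ (fderiv ℝ φ) z) z :=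
    ((hφ.fderiv_right (m := ∞) (by simp)).differentiableAt (by simp)).hasFDerivAt
  generalize hδ : (((0, ξ z), -(p ∘L fderiv ℝ ξ z ∘L ContinuousLinearMap.inr ℝ U V)) :
    (U × V) × (V →L[ℝ] U)) = δ
  -- A straight line in the direction of the lift. As the lift has no base component, the relation
  -- `hSrel`, assumed only over the base point `z.1`, holds along it for small `t`.
  obtain ⟨γ, hγdef⟩ : ∃ γ : ℝ → (U × V) × (V →L[ℝ] U), γ = fun t => (z, p) + t • δ := ⟨_, rfl⟩
  have hγ : HasDerivAt γ δ 0 := by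
    rw [hγdef]
    simpa using ((hasDerivAt_id (0 : ℝ)).smul_const δ).const_add (z, p)
  have hγ0 : γ 0 = (z, p) := by simp [hγdef]
  have hγ1 : ∀ t, (γ t).1.1 = z.1 := fun t => by simp [hγdef, ← hδ]
  have h2 := fderiv_momentum_along_curve hγ (by rwa [hγ0]) (by rwa [hγ0]) G a (by
    have h := hγ.continuousAt.tendsto
    rw [hγ0] at h
    filter_upwards [h.eventually hSrel] with t ht
    exact ht (hγ1 t) a)
  rw [hγ0] at h2
  have h3 := hSrel.self_of_nhds rfl (fderiv ℝ ξ z (0, a))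
  have h4 : G (δ.2 a) = -S (z, p) (fderiv ℝ φ z (0, fderiv ℝ ξ z (0, a))).2 := by
    rw [h3, ← hδ]; simp
  have h5 : δ.1 = (0, ξ z) := by rw [← hδ]
  rw [h4, h5] at h2
  rw [h1, map_add, neg_add, ← h2]
  abel

end

/-! ### Components of vertical fields and coordinate changes of `P`. -/

noncomputable section

namespace SmoothFibreBundle

variable {n N : ℕ} {M E F : Type*}
  [TopologicalSpace M] [ChartedSpace (EuclideanSpace ℝ (Fin n)) M]
  [TopologicalSpace E] [ChartedSpace (EuclideanSpace ℝ (Fin (n + N))) E]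
  [TopologicalSpace F] [ChartedSpace (EuclideanSpace ℝ (Fin N)) F]
  [IsManifold (𝓡 n) ∞ M] [IsManifold (𝓡 N) ∞ F] [IsManifold (𝓡 (n + N)) ∞ E]
  {B : SmoothFibreBundle n N M E F} {X : (e : E) → TangentSpace (𝓡 (n + N)) e}

theorem AdaptedChart.contDiffOn_component (c : B.AdaptedChart) (hX : B.IsVerticalField X) :
    ContDiffOn ℝ ∞ (c.component X) c.tot.target := by
  have h1 := c.tot_smooth.contMDiffOn_tangentMapWithin (m := ∞) (by simp)
    c.tot.open_source.uniqueMDiffOn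
  have h2 : ContMDiffOn 𝓘(ℝ, EuclideanSpace ℝ (Fin n) × EuclideanSpace ℝ (Fin N))
      (𝓡 (n + N)).tangent ∞
      (fun y => (⟨c.tot.symm y, X (c.tot.symm y)⟩ : TangentBundle (𝓡 (n + N)) E)) c.tot.target :=
    hX.1.comp_contMDiffOn c.tot_symm_smooth
  have h3 := (contMDiff_snd_tangentBundle_modelSpace
    (EuclideanSpace ℝ (Fin n) × EuclideanSpace ℝ (Fin N))
    𝓘(ℝ, EuclideanSpace ℝ (Fin n) × EuclideanSpace ℝ (Fin N)) (n := ∞)).comp_contMDiffOn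
    (h1.comp h2 fun y hy => c.tot.map_target hy)
  refine contDiff_snd.comp_contDiffOn (h3.contDiffOn.congr fun y hy => ?_)
  change c.dTot _ _ = mfderivWithin _ _ _ _ _ _
  rw [mfderivWithin_of_isOpen c.tot.open_source (c.tot.map_target hy)]
  rfl

theorem AdaptedChart.totEquiv_vertical (c : B.AdaptedChart) (hX : B.IsVerticalField X) {e : E}
    (he : e ∈ c.tot.source) : c.totEquiv he (X e) = (0, c.component X (c.tot e)) := by
  refine Prod.ext ?_ ?_
  · have h : B.tangentProj e (X e) = 0 := hX.2 e
    rw [c.fst_totEquiv, h, map_zero]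
  · have h : ∀ e', e' = e → (c.totEquiv he (X e)).2 = (c.dTot e' (X e')).2 := by
      rintro _ rfl; rfl
    exact h _ (c.tot.left_inv he)

variable (X) in
/-- The coordinate expression of the canonical lift of a vertical vector field. -/
def AdaptedChart.liftCoord (c : B.AdaptedChart) (y : PhaseModel n N) : PhaseModel n N :=
  ((0, c.component X y.1), -(y.2 ∘L fderiv ℝ (c.component X) y.1 ∘L
    ContinuousLinearMap.inr ℝ (EuclideanSpace ℝ (Fin n)) (EuclideanSpace ℝ (Fin N))))

theorem AdaptedChart.isOpen_phaseOverlap (c c' : B.AdaptedChart) :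
    IsOpen {y : PhaseModel n N | y.1 ∈ c.overlap c'} :=
  (c.tot.symm ≫ₕ c'.tot).open_source.preimage continuous_fst

theorem AdaptedChart.phaseChart_mem_overlap (c c' : B.AdaptedChart) {q : B.Phase}
    (hq : B.toTotal q ∈ c.tot.source) (hq' : B.toTotal q ∈ c'.tot.source) :
    (c.phaseChart q).1 ∈ c.overlap c' := by
  refine ⟨c.tot.map_source hq, ?_⟩
  change c.tot.symm (c.tot (B.toTotal q)) ∈ c'.tot.source
  rwa [c.tot.left_inv hq]

theorem AdaptedChart.dPhase_inverse_dPhase (c c' : B.AdaptedChart) {q : B.Phase}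
    (hq : q ∈ c.phaseChart.source) (hq' : q ∈ c'.phaseChart.source) (w : PhaseModel n N) :
    c'.dPhase q ((c.dPhase q).inverse w) = fderiv ℝ (c.phaseTransition c') (c.phaseChart q) w := by
  have hy := c.phaseChart.map_source hq
  have h1 := (c.phaseChart_mdifferentiable.mdifferentiableAt_symm hy).hasMFDerivAt
  have h2 : HasMFDerivAt 𝓘(ℝ, PhaseModel n N) 𝓘(ℝ, PhaseModel n N)
      c'.phaseChart (c.phaseChart.symm (c.phaseChart q)) (c'.dPhase q) := by
    rw [c.phaseChart.left_inv hq]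
    exact (c'.phaseChart_mdifferentiable.mdifferentiableAt hq').hasMFDerivAt
  have h3 := h2.comp (c.phaseChart q) h1
  have h4 : (c'.phaseChart ∘ c.phaseChart.symm) =ᶠ[nhds (c.phaseChart q)]
      c.phaseTransition c' := by
    filter_upwards [(c.isOpen_phaseOverlap c').mem_nhds (c.phaseChart_mem_overlap c' hq hq')]
      with y hy
    exact c.phaseEquiv_transition c' hy
  have h5 : HasFDerivAt (c.phaseTransition c')
      (c'.dPhase q ∘L ((c.dPhaseEquiv hq).symm : PhaseModel n N →L[ℝ] B.PhaseTangent q))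
      (c.phaseChart q) :=
    hasMFDerivAt_iff_hasFDerivAt.1 (h3.congr_of_eventuallyEq h4.symm)
  rw [h5.fderiv, c.inverse_dPhase hq]
  rfl

end SmoothFibreBundle

end

/-! ### Existence, uniqueness and smoothness of the canonical lift. -/

noncomputable section

namespace SmoothFibreBundle

variable {n N : ℕ} {M E F : Type*}
  [TopologicalSpace M] [ChartedSpace (EuclideanSpace ℝ (Fin n)) M]
  [TopologicalSpace E] [ChartedSpace (EuclideanSpace ℝ (Fin (n + N))) E]
  [TopologicalSpace F] [ChartedSpace (EuclideanSpace ℝ (Fin N)) F]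
  [IsManifold (𝓡 n) ∞ M] [IsManifold (𝓡 N) ∞ F] [IsManifold (𝓡 (n + N)) ∞ E]
  {B : SmoothFibreBundle n N M E F} {X : (e : E) → TangentSpace (𝓡 (n + N)) e}

namespace AdaptedChart

variable (c c' : B.AdaptedChart)

/-- The action of a change of base coordinates on the factor `T_m M ⊗ Λⁿ T_m^* M` of the phase
space. -/
def momentumFactor (m : M) : EuclideanSpace ℝ (Fin n) →L[ℝ] EuclideanSpace ℝ (Fin n) :=
  (stdVol n fun i => c.dBase m ((c'.dBase m).inverse (EuclideanSpace.single i 1))) •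
    (c'.dBase m ∘L (c.dBase m).inverse)

theorem momentumFactor_proj {e : E} (he : e ∈ c.tot.source) (he' : e ∈ c'.tot.source) :
    c.momentumFactor c' (B.proj e) =
      (stdVol n fun i => c.baseEquiv he ((c'.baseEquiv he').symm (EuclideanSpace.single i 1))) •
        ((c'.baseEquiv he' : _ →L[ℝ] _) ∘L
          ((c.baseEquiv he).symm : _ →L[ℝ] TangentSpace (𝓡 n) (B.proj e))) := by
  have h : (c.dBase (B.proj e)).inverse = (c.baseEquiv he).symm := by
    change (c.baseEquiv he : TangentSpace (𝓡 n) (B.proj e) →L[ℝ]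
      EuclideanSpace ℝ (Fin n)).inverse = _
    rw [ContinuousLinearMap.inverse_equiv]
  have h' : (c'.dBase (B.proj e)).inverse = (c'.baseEquiv he').symm := by
    change (c'.baseEquiv he' : TangentSpace (𝓡 n) (B.proj e) →L[ℝ]
      EuclideanSpace ℝ (Fin n)).inverse = _
    rw [ContinuousLinearMap.inverse_equiv]
  rw [momentumFactor, h, h']
  rfl

/-- The vertical blocks of the coordinate change and of its inverse cancel. What is left depends
only on the point of `M`, hence is constant along its fibre. -/
theorem phaseTransition_snd_apply {y : PhaseModel n N} (hy : y.1 ∈ c.overlap c')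
    (a : EuclideanSpace ℝ (Fin N)) :
    (c.phaseTransition c' y).2 (fderiv ℝ (c.transition c') y.1 (0, a)).2 =
      c.momentumFactor c' (B.proj (c.tot.symm y.1)) (y.2 a) := by
  obtain ⟨z, p⟩ := y
  obtain ⟨hz, hz'⟩ : z ∈ c.tot.target ∧ c.tot.symm z ∈ c'.tot.source := hy
  have he := c.tot.map_target hz
  have hb := fun u => c.transition_base c' he hz' u
  have hb' := fun u => c'.transition_base c hz' he u
  have hv := fun u => c.transition_vert c' he hz' u
  have hv' := fun u => c'.transition_vert c hz' he u
  rw [c.tot.right_inv hz] at hb hv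
  rw [c.momentumFactor_proj c' he hz']
  unfold phaseTransition
  dsimp only
  rw [← hv]
  simp only [_root_.smul_apply, ContinuousLinearMap.comp_apply, blockBase,
    blockVert, ContinuousLinearMap.inl_apply, ContinuousLinearMap.inr_apply,
    ContinuousLinearMap.coe_fst', ContinuousLinearMap.coe_snd', ← hb, ContinuousLinearEquiv.coe_coe]
  have h1 : (fderiv ℝ (c'.transition c) (c.transition c' z)
      (0, c'.vertEquiv hz' ((c.vertEquiv he).symm a))).2 = a := by
    refine (hv' _).symm.trans ?_
    rw [ContinuousLinearEquiv.symm_apply_apply, ContinuousLinearEquiv.apply_symm_apply]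
  rw [h1]
  congr 2
  funext i
  exact (hb' _).symm

theorem proj_tot_symm {z : EuclideanSpace ℝ (Fin n) × EuclideanSpace ℝ (Fin N)}
    (hz : z ∈ c.tot.target) : B.proj (c.tot.symm z) = c.base.symm z.1 := by
  have he := c.tot.map_target hz
  have h := c.fst_tot _ he
  rw [c.tot.right_inv hz] at h
  rw [h, c.base.left_inv (c.proj_mem _ he)]

theorem component_transition (hX : B.IsVerticalField X)
    {z : EuclideanSpace ℝ (Fin n) × EuclideanSpace ℝ (Fin N)} (hz : z ∈ c.overlap c') :
    c'.component X (c.transition c' z) =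
      (fderiv ℝ (c.transition c') z (0, c.component X z)).2 := by
  obtain ⟨hz, hz'⟩ : z ∈ c.tot.target ∧ c.tot.symm z ∈ c'.tot.source := hz
  have he := c.tot.map_target hz
  have h1 := c.fderiv_transition c' he hz' (0, c.component X z)
  have h2 := c.totEquiv_vertical hX he
  rw [c.tot.right_inv hz] at h1 h2
  rw [h1, ← h2, ContinuousLinearEquiv.symm_apply_apply, c'.totEquiv_vertical hX]
  rfl

theorem fderiv_transition_vert_fst {e : E} (he : e ∈ c.tot.source) (he' : e ∈ c'.tot.source)
    (a : EuclideanSpace ℝ (Fin N)) : (fderiv ℝ (c.transition c') (c.tot e) (0, a)).1 = 0 := by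
  have h : B.tangentProj e ((c.totEquiv he).symm (0, a)) = 0 := ((c.vertEquiv he).symm a).2
  rw [c.fderiv_transition c' he he', c'.fst_totEquiv, h, map_zero]

theorem phaseTransition_phaseChart {q : B.Phase} (hq : q ∈ c.phaseChart.source)
    (hq' : q ∈ c'.phaseChart.source) :
    c.phaseTransition c' (c.phaseChart q) = c'.phaseChart q := by
  rw [← c.phaseEquiv_transition c' (c.phaseChart_mem_overlap c' hq hq')]
  exact congrArg c'.phaseChart (c.phaseChart.left_inv hq)

/-- Chart independence of the lift. The components along `E` agree since both describe X; the
momentum components agree by `fderiv_canonicalLift_momentum`. -/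
theorem dPhase_inverse_liftCoord (hX : B.IsVerticalField X) {q : B.Phase}
    (hq : B.toTotal q ∈ c.tot.source) (hq' : B.toTotal q ∈ c'.tot.source) :
    c'.dPhase q ((c.dPhase q).inverse (c.liftCoord X (c.phaseChart q))) =
      c'.liftCoord X (c'.phaseChart q) := by
  refine Prod.ext ?_ ?_
  · rw [← c'.totEquiv_tangentToTotal hq', c.tangentToTotal_inverse_dPhase hq]
    have h : (c.totEquiv hq).symm (0, c.component X (c.tot (B.toTotal q))) = X (B.toTotal q) := by
      rw [ContinuousLinearEquiv.symm_apply_eq, c.totEquiv_vertical hX]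
    refine (congrArg _ h).trans ?_
    rw [c'.totEquiv_vertical hX]
    rfl
  · have hz := c.phaseChart_mem_overlap c' hq hq'
    have hφ : ContDiffAt ℝ ∞ (c.transition c') (c.phaseChart q).1 :=
      (c.contDiffOn_transition c').contDiffAt ((c.tot.symm ≫ₕ c'.tot).open_source.mem_nhds hz)
    have hT : ContDiffAt ℝ ∞ (c.phaseTransition c') (c.phaseChart q) :=
      (c.contDiffOn_phaseTransition c').contDiffAt ((c.isOpen_phaseOverlap c').mem_nhds hz)
    have hTd : HasFDerivAt (c.phaseTransition c')
        (fderiv ℝ (c.phaseTransition c') (c.phaseChart q)) (c.phaseChart q) :=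
      (hT.differentiableAt (by simp)).hasFDerivAt
    have hS : HasFDerivAt (fun y => (c.phaseTransition c' y).2)
        (ContinuousLinearMap.snd ℝ _ _ ∘L fderiv ℝ (c.phaseTransition c') (c.phaseChart q))
        (c.phaseChart q) := hTd.snd
    have hφz : c.transition c' (c.phaseChart q).1 = c'.tot (B.toTotal q) :=
      congrArg c'.tot (c.tot.left_inv hq)
    have hξ : DifferentiableAt ℝ (c.component X) (c.phaseChart q).1 :=
      ((c.contDiffOn_component hX).contDiffAt
        (c.tot.open_target.mem_nhds hz.1)).differentiableAt (by simp)
    have hξ' : DifferentiableAt ℝ (c'.component X) (c.transition c' (c.phaseChart q).1) := by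
      rw [hφz]
      exact ((c'.contDiffOn_component hX).contDiffAt
        (c'.tot.open_target.mem_nhds (c'.tot.map_source hq'))).differentiableAt (by simp)
    have hrel : ∀ᶠ z' in nhds (c.phaseChart q).1, c'.component X (c.transition c' z') =
        (fderiv ℝ (c.transition c') z' (0, c.component X z')).2 := by
      filter_upwards [(c.tot.symm ≫ₕ c'.tot).open_source.mem_nhds hz] with z' hz'
      exact c.component_transition c' hX hz'
    have hSrel : ∀ᶠ y in nhds (c.phaseChart q), y.1.1 = (c.phaseChart q).1.1 → ∀ a,
        (c.phaseTransition c' y).2 (fderiv ℝ (c.transition c') y.1 (0, a)).2 =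
          c.momentumFactor c' (c.base.symm (c.phaseChart q).1.1) (y.2 a) := by
      filter_upwards [(c.isOpen_phaseOverlap c').mem_nhds hz] with y hy hyz a
      rw [c.phaseTransition_snd_apply c' hy, c.proj_tot_symm hy.1, hyz]
    have key := fderiv_canonicalLift_momentum hφ hξ hξ' hrel
      (c.fderiv_transition_vert_fst c' hq hq') (p := (c.phaseChart q).2) hS.differentiableAt _ hSrel
    rw [c.dPhase_inverse_dPhase c' hq hq']
    refine ContinuousLinearMap.ext fun b => ?_
    -- The momentum law is known only on images of the vertical block of the derivative; that block
    -- is invertible, so every `b` is such an image.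
    have hb : (fderiv ℝ (c.transition c') (c.phaseChart q).1
        (0, c.vertEquiv hq ((c'.vertEquiv hq').symm b))).2 = b := by
      refine (c.transition_vert c' hq hq' _).symm.trans ?_
      rw [ContinuousLinearEquiv.symm_apply_apply, ContinuousLinearEquiv.apply_symm_apply]
    have h := key (c.vertEquiv hq ((c'.vertEquiv hq').symm b))
    rw [hb, hφz] at h
    have h2 : fderiv ℝ (fun y => (c.phaseTransition c' y).2) (c.phaseChart q) =
        ContinuousLinearMap.snd ℝ _ _ ∘L fderiv ℝ (c.phaseTransition c') (c.phaseChart q) :=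
      hS.fderiv
    have h3 := congrArg (fun f => f (c.liftCoord X (c.phaseChart q)) b) h2
    refine Eq.trans ?_ ((h3.symm.trans h).trans ?_)
    · rfl
    · rw [c.phaseTransition_phaseChart c' hq hq']
      rfl

end AdaptedChart

variable (X) in
theorem isCanonicalLift_iff {Xh : B.PhaseField} : B.IsCanonicalLift X Xh ↔
    ∀ (c : B.AdaptedChart) (q : B.Phase), q ∈ c.phaseChart.source →
      c.dPhase q (Xh q) = c.liftCoord X (c.phaseChart q) := Iff.rfl

theorem existsUnique_isCanonicalLift (hX : B.IsVerticalField X) :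
    ∃! Xh : B.PhaseField, B.IsCanonicalLift X Xh := by
  refine ⟨fun q => ((B.adaptedChartAt (B.toTotal q)).dPhase q).inverse
    ((B.adaptedChartAt (B.toTotal q)).liftCoord X
      ((B.adaptedChartAt (B.toTotal q)).phaseChart q)), ?_, ?_⟩
  · intro c q hq
    exact (B.adaptedChartAt (B.toTotal q)).dPhase_inverse_liftCoord c hX
      (B.mem_adaptedChartAt _) hq
  · intro Xh hXh
    funext q
    have hq := mem_phaseChart_adaptedChartAt q
    rw [← (isCanonicalLift_iff X).1 hXh _ q hq, AdaptedChart.inverse_dPhase_apply _ hq]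

theorem AdaptedChart.contDiffOn_liftCoord (c : B.AdaptedChart) (hX : B.IsVerticalField X) :
    ContDiffOn ℝ ∞ (c.liftCoord X) c.phaseChart.target := by
  have h1 : ContDiffOn ℝ ∞ (fun y : PhaseModel n N => c.component X y.1) c.phaseChart.target :=
    (c.contDiffOn_component hX).comp contDiff_fst.contDiffOn fun y hy => hy
  have h2 : ContDiffOn ℝ ∞ (fun y : PhaseModel n N => fderiv ℝ (c.component X) y.1)
      c.phaseChart.target :=
    ((c.contDiffOn_component hX).fderiv_of_isOpen c.tot.open_target (m := ∞) (by simp)).comp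
      contDiff_fst.contDiffOn fun y hy => hy
  exact (contDiffOn_const.prodMk h1).prodMk
    (contDiff_snd.contDiffOn.clm_comp (h2.clm_comp contDiffOn_const)).neg

theorem IsCanonicalLift.isSmoothField (hX : B.IsVerticalField X) {Xh : B.PhaseField}
    (hXh : B.IsCanonicalLift X Xh) : B.IsSmoothField Xh := by
  intro q₀
  obtain ⟨c, hc⟩ : ∃ c : B.AdaptedChart, q₀ ∈ c.phaseChart.source :=
    B.exists_adaptedChart (B.toTotal q₀)
  have h1 := contMDiffOn_vectorSpace_iff_contDiffOn.2 (c.contDiffOn_liftCoord hX)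
  have h2 := c.contMDiffOn_phaseChart_symm.contMDiffOn_tangentMapWithin (m := ∞) (by simp)
    c.phaseChart.open_target.uniqueMDiffOn
  have h3 := (h2.comp h1 fun y hy => hy).comp c.contMDiffOn_phaseChart
    fun q hq => c.phaseChart.map_source hq
  refine (h3.congr fun q hq => ?_).contMDiffAt (c.phaseChart.open_source.mem_nhds hc)
  have hy := c.phaseChart.map_source hq
  -- Transports the identity from `phaseChart.symm (phaseChart q)` to `q` in the tangent bundle,
  -- where the base points are only propositionally equal.
  have h4 : ∀ q', q' = q → ∀ f : PhaseModel n N →L[ℝ] B.PhaseTangent q',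
      f = (c.dPhase q').inverse → (⟨q, Xh q⟩ : TangentBundle 𝓘(ℝ, PhaseModel n N) B.Phase) =
        ⟨q', f (c.liftCoord X (c.phaseChart q))⟩ := by
    rintro _ rfl _ rfl
    rw [← (isCanonicalLift_iff X).1 hXh _ _ hq, c.inverse_dPhase_apply hq]
  refine h4 _ (c.phaseChart.left_inv hq) _ ?_
  rw [← c.mfderiv_phaseChart_symm hy]
  exact mfderivWithin_of_isOpen c.phaseChart.open_target hy

end SmoothFibreBundle

end

/-! ### I(X) is a Hamiltonian form of the canonical lift. -/

noncomputable section

namespace SmoothFibreBundle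

variable {k N : ℕ} {M E F : Type*}
  [TopologicalSpace M] [ChartedSpace (EuclideanSpace ℝ (Fin (k + 1))) M]
  [TopologicalSpace E] [ChartedSpace (EuclideanSpace ℝ (Fin (k + 1 + N))) E]
  [TopologicalSpace F] [ChartedSpace (EuclideanSpace ℝ (Fin N)) F]
  [IsManifold (𝓡 (k + 1)) ∞ M] [IsManifold (𝓡 N) ∞ F] [IsManifold (𝓡 (k + 1 + N)) ∞ E]
  {B : SmoothFibreBundle (k + 1) N M E F} (Γ : B.Connection)
  (Λ : CovariantDerivative (𝓡 (k + 1)) (EuclideanSpace ℝ (Fin (k + 1)))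
    (fun m : M => TangentSpace (𝓡 (k + 1)) m))
  {X : (e : E) → TangentSpace (𝓡 (k + 1 + N)) e} {Xh : B.PhaseField}

/-- The lift is vertical over `M`, so it survives only in the argument that goes through P_Γ; there
it projects to the vertical field X, which P_Γ fixes. -/
theorem Connection.contract_theta_apply (hX : B.IsVerticalField X) (hXh : B.IsCanonicalLift X Xh)
    (c : B.AdaptedChart) {q : B.Phase} (hq : B.toTotal q ∈ c.tot.source)
    (v : Fin k → B.PhaseTangent q) :
    Γ.theta.contract Xh q v =
      hamStd k N ((c.phaseChart q).2 (c.component X (c.phaseChart q).1))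
        (fun j => c.dPhase q (v j)) := by
  have hlift := (isCanonicalLift_iff X).1 hXh c q hq
  refine (Γ.theta_apply c hq (Fin.cons (Xh q) v)).trans ?_
  rw [Fin.sum_univ_succ, Finset.sum_eq_zero, add_zero]
  · have h1 : B.tangentToTotal q (Xh q) = X (B.toTotal q) := by
      apply (c.totEquiv hq).injective
      rw [c.totEquiv_tangentToTotal hq, hlift, c.totEquiv_vertical hX]
      rfl
    have h2 : (c.totEquiv hq (Γ.vert (B.toTotal q) (B.tangentToTotal q (Xh q)))).2 =
        c.component X (c.phaseChart q).1 := by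
      rw [h1, Γ.vert_of_mem _ _ (hX.2 _), c.totEquiv_vertical hX]
      rfl
    rw [Fin.cons_zero, h2]
    simp
  · intro i _
    obtain ⟨j, hj⟩ := Fin.exists_succAbove_eq (Fin.succ_ne_zero i).symm
    rw [hamStd_eq_zero _ j, mul_zero]
    rw [hj, Fin.cons_zero, hlift]
    rfl

theorem Connection.isHorizontal_contract_theta (hX : B.IsVerticalField X)
    (hXh : B.IsCanonicalLift X Xh) : (Γ.theta.contract Xh).IsHorizontal := by
  intro q v i hv
  have hq := mem_phaseChart_adaptedChartAt q
  rw [Γ.contract_theta_apply hX hXh (B.adaptedChartAt (B.toTotal q)) hq]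
  refine hamStd_eq_zero _ i ?_
  rw [← AdaptedChart.dBaseEquiv_tangentToBase _ hq, hv, map_zero]

theorem Connection.contract_theta_inChart (hX : B.IsVerticalField X)
    (hXh : B.IsCanonicalLift X Xh) (c : B.AdaptedChart) {y : PhaseModel (k + 1) N}
    (hy : y ∈ c.phaseChart.target) :
    (Γ.theta.contract Xh).inChart c y = hamStd k N (y.2 (c.component X y.1)) := by
  have hq := c.phaseChart.map_target hy
  ext v
  refine (PhaseForm.inChart_apply c (Γ.theta.contract Xh) hy v).trans ?_
  rw [Γ.contract_theta_apply hX hXh c hq,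
    c.phaseChart.right_inv hy]
  congr 1
  funext j
  exact c.dPhase_inverse_apply hq _

theorem Connection.isSmooth_contract_theta (hX : B.IsVerticalField X)
    (hXh : B.IsCanonicalLift X Xh) : (Γ.theta.contract Xh).IsSmooth := by
  intro c
  have h1 : ContDiffOn ℝ ∞ (fun y : PhaseModel (k + 1) N => c.component X y.1)
      c.phaseChart.target :=
    (c.contDiffOn_component hX).comp contDiff_fst.contDiffOn fun y hy => hy
  have h2 : ContDiff ℝ ∞ (hamStd k N) :=
    ContinuousLinearMap.contDiff (F := PhaseModel (k + 1) N [⋀^Fin k]→L[ℝ] ℝ) _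
  exact (h2.comp_contDiffOn (contDiff_snd.contDiffOn.clm_apply h1)).congr
    fun y hy => Γ.contract_theta_inChart hX hXh c hy

theorem Connection.fderiv_contract_theta_inChart (hX : B.IsVerticalField X)
    (hXh : B.IsCanonicalLift X Xh) (c : B.AdaptedChart) {y : PhaseModel (k + 1) N}
    (hy : y ∈ c.phaseChart.target) (w : PhaseModel (k + 1) N)
    (v : Fin k → PhaseModel (k + 1) N) :
    fderiv ℝ ((Γ.theta.contract Xh).inChart c) y w v =
      hamStd k N (w.2 (c.component X y.1) + y.2 (fderiv ℝ (c.component X) y.1 w.1)) v := by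
  have hξ : HasFDerivAt (c.component X) (fderiv ℝ (c.component X) y.1) y.1 :=
    (((c.contDiffOn_component hX).contDiffAt
      (c.tot.open_target.mem_nhds hy)).differentiableAt (by simp)).hasFDerivAt
  have h1 : HasFDerivAt (fun y : PhaseModel (k + 1) N => y.2 (c.component X y.1)) _ y :=
    (hasFDerivAt_snd (𝕜 := ℝ) (p := y)).clm_apply (hξ.comp y (hasFDerivAt_fst (𝕜 := ℝ) (p := y)))
  have h2 := (ContinuousAlternatingMap.apply ℝ (PhaseModel (k + 1) N) ℝ v ∘L
    hamStd k N).hasFDerivAt.comp y h1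
  have h3 : (fun y => (Γ.theta.contract Xh).inChart c y v) =ᶠ[nhds y]
      (ContinuousAlternatingMap.apply ℝ (PhaseModel (k + 1) N) ℝ v ∘L hamStd k N) ∘
        fun y => y.2 (c.component X y.1) := by
    filter_upwards [c.phaseChart.open_target.mem_nhds hy] with y' hy'
    rw [Γ.contract_theta_inChart hX hXh c hy']
    rfl
  have h4 := hasFDerivAt_alternating_apply
    ((Γ.isSmooth_contract_theta hX hXh).differentiableAt c hy).hasFDerivAt v
  refine (congrArg (fun f => f w) (h4.unique (h2.congr_of_eventuallyEq h3))).trans ?_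
  change hamStd k N (y.2 (fderiv ℝ (c.component X) y.1 w.1) + w.2 (c.component X y.1)) v = _
  rw [add_comm (y.2 _)]

theorem Connection.isHamiltonianFor_contract_theta (hX : B.IsVerticalField X)
    (hXh : B.IsCanonicalLift X Xh) : Γ.IsHamiltonianFor Λ (Γ.theta.contract Xh) Xh := by
  have hH := Γ.isHorizontal_contract_theta hX hXh
  refine ⟨hXh.isSmoothField hX, Γ.isSmooth_contract_theta hX hXh, hH, ?_⟩
  funext q
  obtain ⟨c, hc⟩ : ∃ c, c = B.adaptedChartAt (B.toTotal q) := ⟨_, rfl⟩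
  have hq : q ∈ c.phaseChart.source := hc ▸ mem_phaseChart_adaptedChartAt q
  obtain ⟨y, hy, rfl⟩ : ∃ y ∈ c.phaseChart.target, c.phaseChart.symm y = q :=
    ⟨_, c.phaseChart.map_source hq, c.phaseChart.left_inv hq⟩
  rw [hH.vertDiff_eq_contract_iff Γ Λ Xh c hc hy]
  intro v
  have hlift := (isCanonicalLift_iff X).1 hXh c _ hq
  rw [c.phaseChart.right_inv hy] at hlift
  rw [hlift, c.horFrameEquiv_symm_of_vert _ hy _ rfl, dThetaStd_cons, thetaStd_apply,
    ContinuousAlternatingMap.alternatizeUncurryFin_apply, neg_sub, ← Finset.sum_sub_distrib]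
  -- The identity holds term by term: the derivative of `p` matches Θ at the momentum of `v i`, and
  -- the derivative of `X^A` matches Θ at the momentum `-p ∘ ∂X` of the lift; its minus sign is the
  -- one required.
  refine Finset.sum_congr rfl fun i _ => ?_
  rw [thetaStd_cons _ _ rfl, ContinuousLinearMap.comp_apply,
    Γ.fderiv_contract_theta_inChart hX hXh c hy, map_add,
    ← mul_sub, zsmul_eq_mul]
  push_cast
  congr 1
  simp [AdaptedChart.liftCoord, vertPart_apply]

end SmoothFibreBundle

end

/-- Hamiltonian `1`-vector fields; the dimension of the base manifold is `n = k + 1`. -/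
theorem lemma6 {k N : ℕ} {M E F : Type*}
    [TopologicalSpace M] [ChartedSpace (EuclideanSpace ℝ (Fin (k + 1))) M]
    [TopologicalSpace E] [ChartedSpace (EuclideanSpace ℝ (Fin (k + 1 + N))) E]
    [TopologicalSpace F] [ChartedSpace (EuclideanSpace ℝ (Fin N)) F]
    [IsManifold (𝓡 (k + 1)) ∞ M] [IsManifold (𝓡 N) ∞ F] [IsManifold (𝓡 (k + 1 + N)) ∞ E]
    (B : SmoothFibreBundle (k + 1) N M E F) (Γ : B.Connection)
    (Λ : CovariantDerivative (𝓡 (k + 1)) (EuclideanSpace ℝ (Fin (k + 1)))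
      (fun m : M => TangentSpace (𝓡 (k + 1)) m))
    [CovariantDerivative.ContMDiffCovariantDerivative Λ ∞] :
    (1 ≤ k → ∀ X : B.PhaseField, Γ.IsHamiltonian Λ X → B.IsProjectable X) ∧
    (∀ X : (e : E) → TangentSpace (𝓡 (k + 1 + N)) e, B.IsVerticalField X →
      (∃! Xh : B.PhaseField, B.IsCanonicalLift X Xh) ∧
      ∀ Xh : B.PhaseField, B.IsCanonicalLift X Xh →
        Γ.IsHamiltonian Λ Xh ∧ Γ.IsHamiltonianFor Λ (Γ.theta.contract Xh) Xh) := by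
  refine ⟨fun hk X hX => SmoothFibreBundle.isProjectable_of_isHamiltonian Γ Λ hk hX,
    fun X hX => ⟨SmoothFibreBundle.existsUnique_isCanonicalLift hX, fun Xh hXh => ?_⟩⟩
  have h := Γ.isHamiltonianFor_contract_theta Λ hX hXh
  exact ⟨⟨_, h⟩, h⟩
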